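/- **Setting.** Let $\mathcal A$ be a finite non-empty set and let $(\bar O_t)_{t\ge1}$, $\bar O_t=(O_{\alpha,t})_{\alpha\in\mathcal A}$, be random elements of $\mathcal O^{\mathcal A}$ ($\mathcal O$ a measurable space) on a standard Borel probability space. Put $F_t=\sigma(\bar O_1,\dots,\bar O_t)$, $F_0$ trivial, and $\bar Z_t=(Z_{\alpha,t})_{\alpha\in\mathcal A}=\mathrm{Summ}(\bar O_t)\in\mathcal Z^{\mathcal A}$ for a fixed measurable function $\mathrm{Summ}$ (possibly uninformative). Let $\ell:\Theta\to\mathbb R^{\mathcal O\times\mathcal Z}$ be a loss function on a measurable space $\Theta$ with $(\theta,o,z)\mapsto\ell(\theta)(o,z)$ measurable, $\bar\ell(\theta)(\bar O_t,\bar Z_t)=|\mathcal A|^{-1}\sum_{\alpha}\ell(\theta)(O_{\alpha,t},Z_{\alpha,t})$. For $1\le j\le J$, algorithm $j$ maps $\bar O_1,\dots,\bar O_t$ measurably to $\theta_{j,t}\in\Theta_j\subset\Theta$ ($\theta_{j,0}\in\Theta_j$ is fixed). Define $$\widetilde R_{j,t}=\frac1t\sum_{\tau=1}^t\mathbb E\big[\bar\ell(\theta_{j,\tau-1})(\bar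 O_\tau,\bar Z_\tau)\,\big|\,\bar Z_\tau,F_{\tau-1}\big],\qquad \widehat R_{j,t}=\frac1t\sum_{\tau=1}^t\bar\ell(\theta_{j,\tau-1})(\bar O_\tau,\bar Z_\tau),$$ and $\widetilde R_t(\theta)=\frac1t\sum_{\tau=1}^t\mathbb E[\bar\ell(\theta)(\bar O_\tau,\bar Z_\tau)\mid\bar Z_\tau,F_{\tau-1}]$. Let $\widehat j_t\in\arg\min_j\widehat R_{j,t}$ (Super Learner) and $\widetilde j_t\in\arg\min_j\widetilde R_{j,t}$ (oracle), ties being broken arbitrarily (measurably). Let $\theta^\circ\in\Theta$ satisfy $\widetilde R_t(\theta^\circ)\le\widetilde R_t(\theta)$ a.s. for all $j$ and $\theta\in\Theta_j$, and put $\Delta^\circ\ell(\theta)=\ell(\theta)-\ell(\theta^\circ)$. **Assumptions.** - **A0.** $\mathcal G$ is a graph on $\mathcal A$ such that, for all $t\ge1$, if $\alpha\notin\mathcal A'\subset\mathcal A$ has no neighbour in $\mathcal A'$, then $O_{\alpha,t}$ is conditionally independent of $(O_{\alpha',t})_{\alpha'\in\mathcal A'}$ given $F_{t-1}$ and $\bar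 Z_t$. Let $\deg(\mathcal G)$ be 1 plus the maximum degree of $\mathcal G$. - **A1.** All $\ell(\theta)(O_{\alpha,t},Z_{\alpha,t})$ are square integrable; some $\theta^\star\in\Theta$ minimizes a.s. all the risks $\theta\mapsto\mathbb E[\ell(\theta)(O_{\alpha,t},Z_{\alpha,t})\mid Z_{\alpha,t},F_{t-1}]$, $\alpha\in\mathcal A$, $t\ge1$; and for every $\theta\in\Theta$, every sequence $(\theta_t)_{t\ge0}$ of random elements of $\Theta$ adapted to $(F_t)_{t\ge0}$, all $t\ge1$ and all integers $\varepsilon_1,\varepsilon_2\ge0$ with $\varepsilon_1+\varepsilon_2\in\{1,2\}$, writing $L_{\alpha}=\ell(\theta_{t-1})(O_{\alpha,t},Z_{\alpha,t})^{\varepsilon_1}\,\ell(\theta)(O_{\alpha,t},Z_{\alpha,t})^{\varepsilon_2}$, a.s. $\mathbb E[\sum_\alpha L_\alpha\mid\bar Z_t,F_{t-1}]=\sum_\alpha\mathbb E[L_\alpha\mid Z_{\alpha,t},F_{t-1}]$. - **A2.** $b_1>0$ and $\sup_\theta\|\Delta^\circ\ell(\theta)\|_\infty\le b_1$; $b_2\in\,]0,2b_1]$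 and, a.s., for all $\alpha$, $t\ge1$, $\theta$: $\big|\Delta^\circ\ell(\theta)(O_{\alpha,t},Z_{\alpha,t})-\mathbb E[\Delta^\circ\ell(\theta)(O_{\alpha,t},Z_{\alpha,t})\mid Z_{\alpha,t},F_{t-1}]\big|\le b_2$. - **A3.** $\beta\in\,]0,1]$, $\gamma>0$ and, a.s., for all $\alpha$, $t\ge1$, $\theta$: $\mathbb E[\Delta^\circ\ell(\theta)(O_{\alpha,t},Z_{\alpha,t})\mid Z_{\alpha,t},F_{t-1}]\ge0$ and $\mathbb E[(\Delta^\circ\ell(\theta)(O_{\alpha,t},Z_{\alpha,t}))^2\mid Z_{\alpha,t},F_{t-1}]\le\gamma\big(\mathbb E[\Delta^\circ\ell(\theta)(O_{\alpha,t},Z_{\alpha,t})\mid Z_{\alpha,t},F_{t-1}]\big)^\beta$. - **A4.** $v_1>0$ and, a.s., for all $\alpha$, $t\ge1$, $\theta$: $\mathrm{Var}[\Delta^\circ\ell(\theta)(O_{\alpha,t},Z_{\alpha,t})\mid Z_{\alpha,t},F_{t-1}]\le v_1$. (In A2–A4 the conditional moments given $(Z_{\alpha,t},F_{t-1})$ are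 computed with a regular conditional probability.) **Claim.** Assume A0–A4 and let $a\in\,]0,1]$, $t\ge1$. Put $$v_2=\tfrac{3\pi}2\Big[\Big(\tfrac{15b_2}{|\mathcal A|/\deg(\mathcal G)}\Big)^2+\tfrac{64v_1}{|\mathcal A|/\deg(\mathcal G)}\Big],\quad C_1(a)=2^{5-\beta}(1+a)^2\gamma/a^\beta,\quad C_2(a)=8(1+a)b_2/3,\quad C_3=\frac{(v_2/\gamma)^{(2-\beta)/\beta}}{2^{5-\beta}\gamma},$$ $$C_1'(a)=2^{6+2\beta}e^2(1+a)^2\gamma/a^\beta,\quad C_2'(a)=60e(1+a)b_2,\quad C_3'=\frac{b_1}{2^{6+2\beta}e^2\gamma}.$$ The random variable $U=\widetilde R_{\widehat j_t,t}-\widetilde R_t(\theta^\circ)-(1+2a)\big(\widetilde R_{\widetilde j_t,t}-\widetilde R_t(\theta^\circ)\big)$ is integrable; for every integer $N\ge2$ with $N\ge\frac{\beta}{2-\beta}\,\frac{\log t+\log C_3}{\log2}$, $$\mathbb E[U]\le3\Big(\frac{C_1(a)}t\log(2JN)\Big)^{1/(2-\beta)}+\frac{2C_2(a)}t\log(2JN);$$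 and for every integer $N'\ge2$ with $N'\ge\frac{\beta}{2-\beta}\,\frac{\log(|\mathcal A|/(t^\beta\deg(\mathcal G)))+\log C_3'}{\log2}$, $$\mathbb E[U]\le3\Big(\frac{C_1'(a)}{|\mathcal A|/(t^\beta\deg(\mathcal G))}\log(2JN')\Big)^{1/(2-\beta)}+\frac{2C_2'(a)}{|\mathcal A|/\deg(\mathcal G)}\log(2JN').$$ -/

import Mathlib

open MeasureTheory ProbabilityTheory

/-- The data of the problem, on a measurable space `Ω` and for a finite index set `𝒜`:
the time series of observations `Ō_t = (O_{α,t})_{α ∈ 𝒜}` (times are `t = 1, 2, …`; the value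
`obs 0` is never used), the fixed summary function `Summ`, and the loss function
`ℓ : Θ → ℝ^{𝒪 × 𝒵}`. The fields that are propositions only express measurability. -/
structure SLModel (Ω 𝒜 𝒪 𝒵 Θ : Type*) [MeasurableSpace Ω] [MeasurableSpace 𝒪]
    [MeasurableSpace 𝒵] [MeasurableSpace Θ] where
  /-- `obs t ω α` is the observation `O_{α,t}(ω)`. -/
  obs : ℕ → Ω → 𝒜 → 𝒪
  measurable_obs : ∀ t, Measurable (obs t)
  /-- the summary function, mapping `Ō_t` to `Z̄_t = (Z_{α,t})_{α ∈ 𝒜}`. -/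
  summ : (𝒜 → 𝒪) → 𝒜 → 𝒵
  measurable_summ : Measurable summ
  /-- the loss function. -/
  loss : Θ → 𝒪 → 𝒵 → ℝ
  measurable_loss : Measurable fun p : Θ × 𝒪 × 𝒵 => loss p.1 p.2.1 p.2.2

namespace SLModel

variable {Ω 𝒜 𝒪 𝒵 Θ : Type*} [mΩ : MeasurableSpace Ω] [MeasurableSpace 𝒪]
  [MeasurableSpace 𝒵] [MeasurableSpace Θ]

section Basic

variable (M : SLModel Ω 𝒜 𝒪 𝒵 Θ)

/-- The summary `Z̄_t = Summ(Ō_t)`; `M.Z t ω α` is `Z_{α,t}(ω)`. -/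
def Z (t : ℕ) (ω : Ω) : 𝒜 → 𝒵 := M.summ (M.obs t ω)

theorem measurable_Z (t : ℕ) : Measurable (M.Z t) :=
  M.measurable_summ.comp (M.measurable_obs t)

/-- `F_t`, the `σ`-field generated by `Ō_1, …, Ō_t` (so that `F_0` is trivial). -/
@[reducible] def F (t : ℕ) : MeasurableSpace Ω :=
  ⨆ τ ∈ Finset.Icc 1 t, MeasurableSpace.comap (M.obs τ) inferInstance

theorem F_le (t : ℕ) : M.F t ≤ mΩ :=
  iSup₂_le fun τ _ => (M.measurable_obs τ).comap_le

/-- `σ(Z̄_t, F_{t-1})`, for `t ≥ 1`. -/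
@[reducible] def jointInfo (t : ℕ) : MeasurableSpace Ω :=
  MeasurableSpace.comap (M.Z t) inferInstance ⊔ M.F (t - 1)

theorem jointInfo_le (t : ℕ) : M.jointInfo t ≤ mΩ :=
  sup_le (M.measurable_Z t).comap_le (M.F_le (t - 1))

/-- `σ(Z_{α,t}, F_{t-1})`, for `t ≥ 1`. -/
@[reducible] def margInfo (α : 𝒜) (t : ℕ) : MeasurableSpace Ω :=
  MeasurableSpace.comap (fun ω => M.Z t ω α) inferInstance ⊔ M.F (t - 1)

/-- `ℓ(θ)(O_{α,t}, Z_{α,t})`, as a random variable. -/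
def lossAt (θ : Θ) (α : 𝒜) (t : ℕ) (ω : Ω) : ℝ := M.loss θ (M.obs t ω α) (M.Z t ω α)

/-- `Δ°ℓ(θ)(O_{α,t}, Z_{α,t}) = ℓ(θ)(O_{α,t}, Z_{α,t}) - ℓ(θ°)(O_{α,t}, Z_{α,t})`. -/
def excessAt (θo θ : Θ) (α : 𝒜) (t : ℕ) (ω : Ω) : ℝ := M.lossAt θ α t ω - M.lossAt θo α t ω

/-- `ℓ̄(θ)(Ō_t, Z̄_t)`, the average over `𝒜` of `ℓ(θ)(O_{α,t}, Z_{α,t})`. -/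
noncomputable def avgLoss [Fintype 𝒜] (θ : Θ) (t : ℕ) (ω : Ω) : ℝ :=
  (1 / (Fintype.card 𝒜 : ℝ)) * ∑ α, M.lossAt θ α t ω

/-- The average cumulative conditional risk till time `t` of a sequence `(ϑ_t)_{t ≥ 0}` of random
elements of `Θ`: `(1/t) ∑_{τ=1}^t E[ℓ̄(ϑ_{τ-1})(Ō_τ, Z̄_τ) | Z̄_τ, F_{τ-1}]`. -/
noncomputable def risk [Fintype 𝒜] (P : Measure Ω) (ϑ : ℕ → Ω → Θ) (t : ℕ) (ω : Ω) : ℝ :=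
  (1 / (t : ℝ)) * ∑ τ ∈ Finset.Icc 1 t,
    (P[fun ω' => M.avgLoss (ϑ (τ - 1) ω') τ ω' | M.jointInfo τ]) ω

/-- The risk `R̃_t(θ)` of the dummy algorithm which is constantly equal to `θ`. -/
noncomputable def constRisk [Fintype 𝒜] (P : Measure Ω) (θ : Θ) (t : ℕ) : Ω → ℝ :=
  M.risk P (fun _ _ => θ) t

/-- The empirical risk till time `t`: `(1/t) ∑_{τ=1}^t ℓ̄(ϑ_{τ-1})(Ō_τ, Z̄_τ)`. -/
noncomputable def empRisk [Fintype 𝒜] (ϑ : ℕ → Ω → Θ) (t : ℕ) (ω : Ω) : ℝ :=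
  (1 / (t : ℝ)) * ∑ τ ∈ Finset.Icc 1 t, M.avgLoss (ϑ (τ - 1) ω) τ ω

/-- The sequence `(θ_t)_{t ≥ 0}` produced by an algorithm: `alg t` maps the
`t` observations `Ō_1, …, Ō_t` to an element of `Θ` (for `t = 0`, a fixed element). -/
def output (alg : (t : ℕ) → (Fin t → 𝒜 → 𝒪) → Θ) (t : ℕ) (ω : Ω) : Θ :=
  alg t fun i => M.obs (i + 1) ω

end Basic

section Assumptions

variable [StandardBorelSpace Ω] (M : SLModel Ω 𝒜 𝒪 𝒵 Θ)
  (P : Measure Ω) [IsProbabilityMeasure P]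

/-- `G` is a conditional dependency graph: if `α` has no neighbour in `A'` (and is not in `A'`
itself), then `O_{α,t}` is independent of `(O_{α',t})_{α' ∈ A'}` given `Z̄_t` and `F_{t-1}`. -/
def A0 (G : SimpleGraph 𝒜) : Prop :=
  ∀ t, 1 ≤ t → ∀ (α : 𝒜) (A' : Set 𝒜), α ∉ A' → (∀ α' ∈ A', ¬ G.Adj α α') →
    CondIndepFun (M.jointInfo t) (M.jointInfo_le t)
      (fun ω => M.obs t ω α) (fun ω (α' : A') => M.obs t ω α') P

/-- `θs` minimizes all the conditional risks, and the conditional moments of the losses given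
`(Z̄_t, F_{t-1})` and given the `(Z_{α,t}, F_{t-1})`'s agree, summed over `α`. The first clause says
that all the conditional moments are well defined. -/
def A1 [Fintype 𝒜] (θs : Θ) : Prop :=
  (∀ θ α t, 1 ≤ t → MemLp (M.lossAt θ α t) 2 P) ∧
  (∀ α t, 1 ≤ t → ∀ θ,
    P[M.lossAt θs α t | M.margInfo α t] ≤ᵐ[P] P[M.lossAt θ α t | M.margInfo α t]) ∧
  (∀ (θ : Θ) (ϑ : ℕ → Ω → Θ), (∀ t, Measurable[M.F t] (ϑ t)) →
    ∀ t, 1 ≤ t → ∀ ε₁ ε₂ : ℕ, (ε₁ + ε₂ = 1 ∨ ε₁ + ε₂ = 2) →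
      P[fun ω => ∑ α, M.lossAt (ϑ (t - 1) ω) α t ω ^ ε₁ * M.lossAt θ α t ω ^ ε₂ | M.jointInfo t]
        =ᵐ[P] fun ω => ∑ α,
          (P[fun ω' => M.lossAt (ϑ (t - 1) ω') α t ω' ^ ε₁ * M.lossAt θ α t ω' ^ ε₂
            | M.margInfo α t]) ω)

/-- Conditional expectation `E[Δ°ℓ(θ)(O_{α,t}, Z_{α,t})^k | Z_{α,t}, F_{t-1}](ω)`, computed with the
regular conditional probability given `(Z_{α,t}, F_{t-1})`, which does not depend on `θ`; statements
"almost surely, for all `θ`" thus make sense. -/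
noncomputable def condMoment (θo θ : Θ) (α : 𝒜) (t k : ℕ) (ω : Ω) : ℝ :=
  ∫ ω', M.excessAt θo θ α t ω' ^ k ∂(condExpKernel P (M.margInfo α t) ω)

/-- Conditional variance `Var[Δ°ℓ(θ)(O_{α,t}, Z_{α,t}) | Z_{α,t}, F_{t-1}](ω)`, computed with the
same regular conditional probability. -/
noncomputable def condVariance (θo θ : Θ) (α : 𝒜) (t : ℕ) (ω : Ω) : ℝ :=
  variance (M.excessAt θo θ α t) (condExpKernel P (M.margInfo α t) ω)

/-- Boundedness of the excess losses. -/
def A2 (θo : Θ) (b₁ b₂ : ℝ) : Prop :=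
  0 < b₁ ∧ (∀ θ o z, |M.loss θ o z - M.loss θo o z| ≤ b₁) ∧
  0 < b₂ ∧ b₂ ≤ 2 * b₁ ∧
  ∀ᵐ ω ∂P, ∀ α t, 1 ≤ t → ∀ θ,
    |M.excessAt θo θ α t ω - M.condMoment P θo θ α t 1 ω| ≤ b₂

/-- The variance bound. The `β`-th power presupposes a nonnegative conditional mean. -/
def A3 (θo : Θ) (β γ : ℝ) : Prop :=
  0 < β ∧ β ≤ 1 ∧ 0 < γ ∧
  ∀ᵐ ω ∂P, ∀ α t, 1 ≤ t → ∀ θ,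
    0 ≤ M.condMoment P θo θ α t 1 ω ∧
      M.condMoment P θo θ α t 2 ω ≤ γ * (M.condMoment P θo θ α t 1 ω) ^ β

/-- Boundedness of the conditional variances. -/
def A4 (θo : Θ) (v₁ : ℝ) : Prop :=
  0 < v₁ ∧ ∀ᵐ ω ∂P, ∀ α t, 1 ≤ t → ∀ θ, M.condVariance P θo θ α t ω ≤ v₁

end Assumptions

end SLModel

namespace SuperLearner

open Classical in
/-- `deg(G)`: one plus the maximum degree of `G`. -/
noncomputable def deg {𝒜 : Type*} [Fintype 𝒜] (G : SimpleGraph 𝒜) : ℕ := 1 + G.maxDegree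

/-- `|𝒜| / deg(G)`. -/
noncomputable def ratio {𝒜 : Type*} [Fintype 𝒜] (G : SimpleGraph 𝒜) : ℝ :=
  (Fintype.card 𝒜 : ℝ) / (deg G : ℝ)

/-- `v₂`, where `r = |𝒜| / deg(G)`. -/
noncomputable def v₂ (r b₂ v₁ : ℝ) : ℝ :=
  3 * Real.pi / 2 * ((15 * b₂ / r) ^ 2 + 64 * v₁ / r)

/-- `C₁(a)`. -/
noncomputable def C₁ (β γ a : ℝ) : ℝ := (2 : ℝ) ^ (5 - β) * (1 + a) ^ 2 * γ / a ^ β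

/-- `C₂(a)`. -/
noncomputable def C₂ (b₂ a : ℝ) : ℝ := 8 * (1 + a) * b₂ / 3

/-- `C₃`, where `v = v₂`. -/
noncomputable def C₃ (β γ v : ℝ) : ℝ :=
  (v / γ) ^ ((2 - β) / β) / ((2 : ℝ) ^ (5 - β) * γ)

/-- `C₁'(a)`. -/
noncomputable def C₁' (β γ a : ℝ) : ℝ :=
  (2 : ℝ) ^ (6 + 2 * β) * Real.exp 1 ^ 2 * (1 + a) ^ 2 * γ / a ^ β

/-- `C₂'(a)`. -/
noncomputable def C₂' (b₂ a : ℝ) : ℝ := 60 * Real.exp 1 * (1 + a) * b₂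

/-- `C₃'`. -/
noncomputable def C₃' (β γ b₁ : ℝ) : ℝ :=
  b₁ / ((2 : ℝ) ^ (6 + 2 * β) * Real.exp 1 ^ 2 * γ)

end SuperLearner

/-! Write r for `ratio G`. The proof rests on one exponential inequality: for every adapted sequence
and every l with |l| · 2b₂ ≤ r, the sum over τ ≤ t of l(excess − conditional mean) −
l²(γ/r)(conditional mean)^β has an exponential moment at most 1. At one time step, each index α
contributes a Bernstein factor. A proper colouring of the dependency graph with `deg G` colours
makes these factors multiply within a colour class, and convexity of exp merges the classes, which
puts 1/`deg G` in the exponent (`IsCondSub.exp_sum_of_dependencyGraph`). The variance condition and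
Jensen turn second moments into the β-th power of the mean (`sum_condExp_sq_le`). Conditioning
successively on the past chains the time steps (`lintegral_exp_sum_avgExcess_le`).

The inequality is applied with +l to the oracle index and with −l to the selected one. Since log x ≤
x − 1, a family of J variables with exponential moments at most 1 has expectation at most log J
along any random index (`le_log_card_sub_one_add_sum_exp`), so no tail integration or peeling is
needed. Weighted AM–GM makes the β-th power linear, and the factor 1 + 2a absorbs it. Tuning l and s
gives `integral_regret_le`, of order (log J/(tr))^(1/(2−β)) + log J/(tr), which gains from t and r
simultaneously. As t ≥ 1, r ≥ 1 and log J ≤ log(2JN), both stated bounds are weakenings of it. -/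

namespace SuperLearner

open scoped ENNReal

/-! ### Conditional bounds tested against nonnegative weights. -/

section CondSub

/-- `E[T | m] ≤ 1`, tested against the nonnegative `m`-measurable functions. -/
def IsCondSub {Ω : Type*} [mΩ : MeasurableSpace Ω] (m : MeasurableSpace Ω) (P : Measure[mΩ] Ω)
    (T : Ω → ℝ≥0∞) : Prop :=
  ∀ W : Ω → ℝ≥0∞, Measurable[m] W → ∫⁻ ω, W ω * T ω ∂P ≤ ∫⁻ ω, W ω ∂P

variable {Ω : Type*} {m : MeasurableSpace Ω} [mΩ : MeasurableSpace Ω]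

/-- The set inequalities compare the two measures with densities T and R once trimmed to m, and W
only sees these trimmed measures. -/
theorem lintegral_mul_le_of_forall_setLIntegral_le {P : Measure Ω} (hm : m ≤ mΩ)
    {T R : Ω → ℝ≥0∞} (hT : Measurable T) (hR : Measurable R)
    (h : ∀ s, MeasurableSet[m] s → ∫⁻ ω in s, T ω ∂P ≤ ∫⁻ ω in s, R ω ∂P)
    {W : Ω → ℝ≥0∞} (hW : Measurable[m] W) :
    ∫⁻ ω, W ω * T ω ∂P ≤ ∫⁻ ω, W ω * R ω ∂P := by
  have key : (P.withDensity T).trim hm ≤ (P.withDensity R).trim hm := by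
    refine Measure.le_iff.2 fun s hs => ?_
    rw [trim_measurableSet_eq hm hs, trim_measurableSet_eq hm hs,
      withDensity_apply _ (hm s hs), withDensity_apply _ (hm s hs)]
    exact h s hs
  have e : ∀ {S : Ω → ℝ≥0∞}, Measurable S →
      ∫⁻ ω, W ω * S ω ∂P = ∫⁻ ω, W ω ∂((P.withDensity S).trim hm) := by
    intro S hS
    rw [lintegral_trim hm hW, lintegral_withDensity_eq_lintegral_mul P hS (hW.mono hm le_rfl)]
    simp [mul_comm]
  rw [e hT, e hR]
  exact lintegral_mono' key le_rfl

/-- Conditional expectation bounds, tested against nonnegative `m`-measurable functions. -/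
theorem lintegral_mul_ofReal_le_of_condExp_le {P : Measure Ω} [IsFiniteMeasure P] (hm : m ≤ mΩ)
    {T R : Ω → ℝ} (hT : Measurable T) (hT0 : ∀ ω, 0 ≤ T ω) (hTi : Integrable T P)
    (hR : Measurable R) (h : P[T | m] ≤ᵐ[P] R)
    {W : Ω → ℝ≥0∞} (hW : Measurable[m] W) :
    ∫⁻ ω, W ω * ENNReal.ofReal (T ω) ∂P ≤ ∫⁻ ω, W ω * ENNReal.ofReal (R ω) ∂P := by
  refine lintegral_mul_le_of_forall_setLIntegral_le hm hT.ennreal_ofReal hR.ennreal_ofReal ?_ hW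
  intro s hs
  rw [← ofReal_integral_eq_lintegral_ofReal hTi.integrableOn (ae_of_all _ hT0),
    ← setIntegral_condExp hm hTi hs]
  have h0 : 0 ≤ᵐ[P] P[T | m] := condExp_nonneg (ae_of_all _ hT0)
  rw [ofReal_integral_eq_lintegral_ofReal integrable_condExp.integrableOn (ae_restrict_of_ae h0)]
  refine lintegral_mono_ae (ae_restrict_of_ae ?_)
  filter_upwards [h] with ω hω using ENNReal.ofReal_le_ofReal hω

end CondSub

/-! ### Disintegration along a sub-σ-field, and conditional independence. -/

section Freezing

variable {Ω : Type*} {m : MeasurableSpace Ω} [mΩ : MeasurableSpace Ω] [StandardBorelSpace Ω]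
  {P : Measure Ω} [IsFiniteMeasure P]

/-- In a conditional expectation given `m`, an `m`-measurable argument may be frozen. -/
theorem condExp_diag_ae_eq_integral_condExpKernel (hm : m ≤ mΩ) {ψ : Ω × Ω → ℝ}
    (hψ : Measurable[m.prod mΩ] ψ) (hi : Integrable (fun ω => ψ (ω, ω)) P) :
    P[fun ω => ψ (ω, ω) | m] =ᵐ[P] fun ω => ∫ ω', ψ (ω, ω') ∂(condExpKernel P m ω) := by
  rcases isEmpty_or_nonempty Ω with h | h
  · exact ae_of_all _ fun ω => (IsEmpty.false ω).elim
  -- `condExpKernel` is defined through m ⊓ mΩ, so the conditional distribution is taken over that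
  -- σ-field and rewritten afterwards.
  have e : m ⊓ mΩ = m := inf_of_le_left hm
  have hψ' : @StronglyMeasurable _ _ _ ((m ⊓ mΩ).prod mΩ) ψ := by
    rw [e]; exact hψ.stronglyMeasurable
  have := @condExp_prod_ae_eq_integral_condDistrib Ω Ω Ω ℝ mΩ _ _ _ mΩ P _ id id (m ⊓ mΩ) ψ _ _
    (measurable_id'' inf_le_right) aemeasurable_id hψ' hi
  simp_rw [condExpKernel_apply_eq_condDistrib]
  rw [MeasurableSpace.comap_id] at this
  refine Filter.EventuallyEq.trans ?_ this
  simp only [id_eq]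
  rw [e]

/-- The law of (ω, ω), with the first coordinate seen only through m, is the composition of the
trimmed measure with the conditional kernel. -/
theorem lintegral_diag_eq_lintegral_condExpKernel {β : Type*} {mβ : MeasurableSpace β}
    (hm : m ≤ mΩ) {f : Ω → β} (hf : Measurable f) {Φ : Ω × β → ℝ≥0∞}
    (hΦ : Measurable[m.prod mβ] Φ) :
    ∫⁻ ω, Φ (ω, f ω) ∂P = ∫⁻ ω, ∫⁻ ω', Φ (ω, f ω') ∂(condExpKernel P m ω) ∂P := by
  have hf2 : Measurable[m.prod mΩ, m.prod mβ] fun p : Ω × Ω => (p.1, f p.2) :=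
    (@measurable_fst _ _ m mΩ).prodMk (hf.comp (@measurable_snd _ _ m mΩ))
  have hΦ2 : Measurable[m.prod mΩ] fun p : Ω × Ω => Φ (p.1, f p.2) := hΦ.comp hf2
  have h1 := @Measure.lintegral_compProd Ω Ω m mΩ (P.trim hm) (condExpKernel P m) _ _ _ hΦ2
  rw [compProd_trim_condExpKernel hm] at h1
  have hd : @Measurable _ _ mΩ (m.prod mΩ) (Function.diag : Ω → Ω × Ω) :=
    (measurable_id'' hm).prodMk measurable_id
  rw [@lintegral_map _ _ mΩ (m.prod mΩ) _ _ _ hΦ2 hd] at h1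
  rw [lintegral_trim hm] at h1
  · exact h1
  · exact @Measurable.lintegral_kernel_prod_right _ _ m mΩ (condExpKernel P m) _
      (fun ω ω' => Φ (ω, f ω')) hΦ2

/-- If `f` and `g` are conditionally independent given `m`, a factor `T` built on `m` and `f` whose
conditional expectation given `m` is at most one can be dropped from a product with a factor built
on `m` and `g`. -/
theorem IsCondSub.lintegral_mul_le_of_condIndepFun {β γ : Type*} {mβ : MeasurableSpace β}
    {mγ : MeasurableSpace γ} (hm : m ≤ mΩ) {f : Ω → β} {g : Ω → γ} (hf : Measurable f)
    (hg : Measurable g) (h : CondIndepFun m hm f g P) {T V : Ω → ℝ≥0∞}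
    (hT : Measurable[m ⊔ mβ.comap f] T) (hV : Measurable[m ⊔ mγ.comap g] V)
    (hsub : IsCondSub m P T) :
    ∫⁻ ω, T ω * V ω ∂P ≤ ∫⁻ ω, V ω ∂P := by
  -- This form of the σ-field makes T a function Φ(ω, f ω) that is m-measurable in its first
  -- argument; likewise for V and g.
  have e1 : m ⊔ mβ.comap f = (m.prod mβ).comap fun ω => (ω, f ω) := by
    have := @MeasurableSpace.comap_prodMk Ω Ω β m mβ id f
    rw [MeasurableSpace.comap_id] at this
    exact this.symm
  have e2 : m ⊔ mγ.comap g = (m.prod mγ).comap fun ω => (ω, g ω) := by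
    have := @MeasurableSpace.comap_prodMk Ω Ω γ m mγ id g
    rw [MeasurableSpace.comap_id] at this
    exact this.symm
  rw [e1] at hT
  rw [e2] at hV
  obtain ⟨Φ, hΦ, rfl⟩ := @Measurable.exists_eq_measurable_comp _ _ _ (m.prod mβ) _ _ _ _ _ hT
  obtain ⟨Ψ, hΨ, rfl⟩ := @Measurable.exists_eq_measurable_comp _ _ _ (m.prod mγ) _ _ _ _ _ hV
  have hk : Measurable[m] fun ω => ∫⁻ ω', Φ (ω, f ω') ∂(condExpKernel P m ω) :=
    @Measurable.lintegral_kernel_prod_right _ _ m mΩ (condExpKernel P m) _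
      (fun ω ω' => Φ (ω, f ω')) (hΦ.comp ((@measurable_fst _ _ m mΩ).prodMk
        (hf.comp (@measurable_snd _ _ m mΩ))))
  have hl : Measurable[m] fun ω => ∫⁻ ω', Ψ (ω, g ω') ∂(condExpKernel P m ω) :=
    @Measurable.lintegral_kernel_prod_right _ _ m mΩ (condExpKernel P m) _
      (fun ω ω' => Ψ (ω, g ω')) (hΨ.comp ((@measurable_fst _ _ m mΩ).prodMk
        (hg.comp (@measurable_snd _ _ m mΩ))))
  have hΨ0 := lintegral_diag_eq_lintegral_condExpKernel (P := P) hm hg hΨ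
  have hlΦ : Measurable[m.prod mβ] fun p : Ω × β =>
      (∫⁻ ω', Ψ (p.1, g ω') ∂(condExpKernel P m p.1)) * Φ p :=
    (hl.comp (@measurable_fst _ _ m mβ)).mul hΦ
  have hΦ0 := lintegral_diag_eq_lintegral_condExpKernel (P := P) hm hf hlΦ
  have hprod : ∫⁻ ω, Φ (ω, f ω) * Ψ (ω, g ω) ∂P
      = ∫⁻ ω, (∫⁻ ω', Φ (ω, f ω') ∂(condExpKernel P m ω))
        * (∫⁻ ω', Ψ (ω, g ω') ∂(condExpKernel P m ω)) ∂P := by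
    have hmap := (condIndepFun_iff_map_prod_eq_prod_comp_trim hf hg).1 h
    have hF : Measurable[m.prod (mβ.prod mγ)] fun p : Ω × β × γ => Φ (p.1, p.2.1) * Ψ (p.1, p.2.2) :=
      (hΦ.comp ((@measurable_fst _ _ m (mβ.prod mγ)).prodMk
        (measurable_fst.comp (@measurable_snd _ _ m (mβ.prod mγ))))).mul
      (hΨ.comp ((@measurable_fst _ _ m (mβ.prod mγ)).prodMk
        (measurable_snd.comp (@measurable_snd _ _ m (mβ.prod mγ)))))
    have hid : Measurable[mΩ, m.prod (mβ.prod mγ)] fun ω => (ω, f ω, g ω) :=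
      (measurable_id'' hm).prodMk (hf.prodMk hg)
    rw [← @lintegral_map _ _ mΩ (m.prod (mβ.prod mγ)) P _ _ hF hid, hmap,
      Measure.lintegral_bind (Kernel.measurable _).aemeasurable hF.aemeasurable]
    have hkl : Measurable[m] fun ω => (∫⁻ ω', Φ (ω, f ω') ∂(condExpKernel P m ω))
        * (∫⁻ ω', Ψ (ω, g ω') ∂(condExpKernel P m ω)) := hk.mul hl
    rw [← lintegral_trim hm hkl]
    refine lintegral_congr fun ω => ?_
    have hΦω : Measurable fun b => Φ (ω, b) := hΦ.comp (@measurable_prodMk_left _ _ m mβ ω)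
    have hΨω : Measurable fun b => Ψ (ω, b) := hΨ.comp (@measurable_prodMk_left _ _ m mγ ω)
    rw [Kernel.lintegral_id_prod hF, Kernel.lintegral_prod]
    · simp only [Kernel.map_apply _ hf, Kernel.map_apply _ hg]
      simp_rw [lintegral_const_mul _ hΨω, lintegral_map hΨω hg]
      rw [lintegral_map (hΦω.mul_const _) hf, lintegral_mul_const]
      exact hΦω.comp hf
    · exact hF.comp (@measurable_prodMk_left _ _ m (mβ.prod mγ) ω)
  -- The factor in g is integrated out first: what remains of it is m-measurable, hence an
  -- admissible weight in `hsub`.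
  calc ∫⁻ ω, Φ (ω, f ω) * Ψ (ω, g ω) ∂P
      = ∫⁻ ω, (∫⁻ ω', Ψ (ω, g ω') ∂(condExpKernel P m ω)) * Φ (ω, f ω) ∂P := by
        rw [hprod, hΦ0]
        refine lintegral_congr fun ω => ?_
        dsimp only
        rw [lintegral_const_mul, mul_comm]
        exact hΦ.comp ((@measurable_const _ _ m mΩ ω).prodMk hf)
    _ ≤ ∫⁻ ω, (∫⁻ ω', Ψ (ω, g ω') ∂(condExpKernel P m ω)) ∂P := hsub _ hl
    _ = _ := hΨ0.symm

end Freezing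

end SuperLearner

namespace SuperLearner

open scoped ENNReal

/-! ### Exponential moments under a dependency graph. -/

section DependencyGraph

open Classical in
/-- Greedy colouring of a finite graph. -/
theorem exists_coloring_deg {V : Type*} [Fintype V] (G : SimpleGraph V) :
    ∃ c : V → Fin (deg G), ∀ u v, G.Adj u v → c u ≠ c v := by
  suffices h : ∀ S : Finset V, ∃ c : V → Fin (deg G), ∀ u ∈ S, ∀ v ∈ S, G.Adj u v → c u ≠ c v by
    obtain ⟨c, hc⟩ := h Finset.univ
    exact ⟨c, fun u v => hc u (Finset.mem_univ _) v (Finset.mem_univ _)⟩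
  intro S
  induction S using Finset.induction_on with
  | empty => exact ⟨fun _ => ⟨0, by simp [deg]⟩, by simp⟩
  | insert w S hw ih =>
    obtain ⟨c, hc⟩ := ih
    -- The neighbours of w occupy at most `G.maxDegree` colours, one fewer than are available.
    obtain ⟨k, hk⟩ : ∃ k, k ∉ (G.neighborFinset w).image c := by
      by_contra! h
      have h1 : Finset.univ ⊆ (G.neighborFinset w).image c := fun k _ => h k
      have h2 := (Finset.card_le_card h1).trans Finset.card_image_le
      rw [Finset.card_univ, Fintype.card_fin, SimpleGraph.card_neighborFinset_eq_degree] at h2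
      have h3 := G.degree_le_maxDegree w
      unfold deg at h2
      have h4 : 1 + G.maxDegree ≤ G.maxDegree := by convert h2.trans h3
      omega
    have hkn : ∀ v, G.Adj w v → c v ≠ k := fun v hv e =>
      hk (Finset.mem_image.2 ⟨v, by simpa using hv, e⟩)
    refine ⟨Function.update c w k, fun u hu v hv huv => ?_⟩
    rcases eq_or_ne u w with rfl | hu'
    · rw [Function.update_self, Function.update_of_ne huv.ne']
      exact (hkn v huv).symm
    · rcases eq_or_ne v w with rfl | hv'
      · rw [Function.update_self, Function.update_of_ne hu']
        exact hkn u huv.symm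
      · rw [Function.update_of_ne hu', Function.update_of_ne hv']
        exact hc u (Finset.mem_of_mem_insert_of_ne hu hu') v
          (Finset.mem_of_mem_insert_of_ne hv hv') huv

theorem deg_pos {V : Type*} [Fintype V] (G : SimpleGraph V) : 0 < deg G := by
  unfold deg; omega

theorem one_le_ratio {V : Type*} [Fintype V] [Nonempty V] (G : SimpleGraph V) : 1 ≤ ratio G := by
  classical
  unfold ratio
  rw [one_le_div (by exact_mod_cast deg_pos G)]
  have : G.maxDegree < Fintype.card V := G.maxDegree_lt_card_verts
  have h : deg G ≤ Fintype.card V := by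
    unfold deg
    convert Nat.succ_le_of_lt this using 1
    rw [Nat.succ_eq_one_add]
  exact_mod_cast h

variable {Ω : Type*} {m : MeasurableSpace Ω} [mΩ : MeasurableSpace Ω]

theorem IsCondSub.mono {P : Measure Ω} {T T' : Ω → ℝ≥0∞} (h : IsCondSub m P T)
    (hle : T' ≤ᵐ[P] T) : IsCondSub m P T' := fun W hW => by
  refine (lintegral_mono_ae ?_).trans (h W hW)
  filter_upwards [hle] with ω hω using mul_le_mul_right hω _

/-- Averaging in the exponent preserves the property of having a conditional expectation at most
one. -/
theorem IsCondSub.exp_average {P : Measure Ω} (hm : m ≤ mΩ) {d : ℕ} (hd : 0 < d)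
    {g : Fin d → Ω → ℝ} (hg : ∀ k, Measurable (g k))
    (h : ∀ k, IsCondSub m P fun ω => ENNReal.ofReal (Real.exp (g k ω))) :
    IsCondSub m P fun ω => ENNReal.ofReal (Real.exp ((1 / (d : ℝ)) * ∑ k, g k ω)) := by
  intro W hW
  have hd0 : (0 : ℝ) < d := by exact_mod_cast hd
  have hd' : (0 : ℝ) ≤ 1 / d := by positivity
  have hsum : ∑ _k : Fin d, (1 / (d : ℝ)) = 1 := by
    simp [hd0.ne']
  have hpt : ∀ ω, ENNReal.ofReal (Real.exp ((1 / (d : ℝ)) * ∑ k, g k ω))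
      ≤ ∑ k, ENNReal.ofReal (1 / (d : ℝ)) * ENNReal.ofReal (Real.exp (g k ω)) := by
    intro ω
    -- Jensen needs no independence between the d variables, which is why different colour classes
    -- may depend on each other.
    have := convexOn_exp.map_sum_le (t := Finset.univ) (w := fun _ : Fin d => 1 / (d : ℝ))
      (p := fun k => g k ω) (fun _ _ => hd') hsum (fun _ _ => Set.mem_univ _)
    simp only [smul_eq_mul, ← Finset.mul_sum] at this
    rw [← Finset.mul_sum, ← ENNReal.ofReal_sum_of_nonneg (fun _ _ => (Real.exp_pos _).le),
      ← ENNReal.ofReal_mul hd']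
    exact ENNReal.ofReal_le_ofReal this
  calc ∫⁻ ω, W ω * ENNReal.ofReal (Real.exp ((1 / (d : ℝ)) * ∑ k, g k ω)) ∂P
      ≤ ∫⁻ ω, ∑ k, ENNReal.ofReal (1 / (d : ℝ)) *
          (W ω * ENNReal.ofReal (Real.exp (g k ω))) ∂P := by
        refine lintegral_mono fun ω => ?_
        refine (mul_le_mul_right (hpt ω) _).trans_eq ?_
        rw [Finset.mul_sum]
        exact Finset.sum_congr rfl fun k _ => by ring
    _ = ∑ k, ENNReal.ofReal (1 / (d : ℝ)) *
          ∫⁻ ω, W ω * ENNReal.ofReal (Real.exp (g k ω)) ∂P := by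
        have hmeas : ∀ k, Measurable fun ω => W ω * ENNReal.ofReal (Real.exp (g k ω)) :=
          fun k => (hW.mono hm le_rfl).mul (hg k).exp.ennreal_ofReal
        rw [lintegral_finsetSum _ fun k _ => (hmeas k).const_mul _]
        exact Finset.sum_congr rfl fun k _ => lintegral_const_mul _ (hmeas k)
    _ ≤ ∑ _k : Fin d, ENNReal.ofReal (1 / (d : ℝ)) * ∫⁻ ω, W ω ∂P :=
        Finset.sum_le_sum fun k _ => mul_le_mul_right (h k W hW) _
    _ = ∫⁻ ω, W ω ∂P := by
        rw [← Finset.sum_mul, ← ENNReal.ofReal_sum_of_nonneg (fun _ _ => hd'), hsum,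
          ENNReal.ofReal_one, one_mul]

variable [StandardBorelSpace Ω] {P : Measure Ω} [IsFiniteMeasure P]

/-- The factors are removed one at a time: the weight times the remaining factors is built on m and
the other observations, from which `O i` is conditionally independent. Independence is asked for all
subsets A of S so that it passes to smaller index sets in the induction. -/
theorem IsCondSub.prod_of_condIndepFun {ι E : Type*} [MeasurableSpace E] (hm : m ≤ mΩ)
    {O : ι → Ω → E} (hO : ∀ i, Measurable (O i)) {T : ι → Ω → ℝ≥0∞}
    (hT : ∀ i, Measurable[m ⊔ MeasurableSpace.comap (O i) inferInstance] (T i))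
    (hsub : ∀ i, IsCondSub m P (T i)) (S : Finset ι)
    (hind : ∀ i ∈ S, ∀ A : Set ι, A ⊆ S → i ∉ A →
      CondIndepFun m hm (O i) (fun ω (j : A) => O j ω) P) :
    IsCondSub m P fun ω => ∏ i ∈ S, T i ω := by
  classical
  induction S using Finset.induction_on with
  | empty => intro W _; simp
  | insert i S hi ih =>
    intro W hW
    have ih' := ih (fun j hj A hA hjA => hind j (Finset.mem_insert_of_mem hj) A
      (hA.trans (by simp)) hjA)
    have hci := hind i (Finset.mem_insert_self i S) (S : Set ι) (by simp) (by simpa using hi)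
    have hrestr : Measurable fun ω (j : (S : Set ι)) => O j ω :=
      measurable_pi_lambda _ fun j => hO j
    have hV : Measurable[m ⊔ MeasurableSpace.comap (fun ω (j : (S : Set ι)) => O j ω) inferInstance]
        fun ω => W ω * ∏ j ∈ S, T j ω := by
      refine (hW.mono le_sup_left le_rfl).mul (Finset.measurable_fun_prod _ fun j hj => ?_)
      refine (hT j).mono (sup_le_sup_left ?_ _) le_rfl
      have : O j = (fun x : ↥(S : Set ι) → E => x ⟨j, hj⟩) ∘ fun ω (j : (S : Set ι)) => O j ω := rfl
      rw [this, ← MeasurableSpace.comap_comp]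
      exact MeasurableSpace.comap_mono (measurable_pi_apply _).comap_le
    calc ∫⁻ ω, W ω * ∏ j ∈ insert i S, T j ω ∂P
        = ∫⁻ ω, T i ω * (W ω * ∏ j ∈ S, T j ω) ∂P := by
          refine lintegral_congr fun ω => ?_
          rw [Finset.prod_insert hi]; ring
      _ ≤ ∫⁻ ω, W ω * ∏ j ∈ S, T j ω ∂P :=
          (hsub i).lintegral_mul_le_of_condIndepFun hm (hO i) hrestr hci (hT i) hV
      _ ≤ ∫⁻ ω, W ω ∂P := ih' W hW

/-- Exponential moments of a sum of variables with a conditional dependency graph. -/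
theorem IsCondSub.exp_sum_of_dependencyGraph {V E : Type*} [Fintype V] [MeasurableSpace E]
    (hm : m ≤ mΩ) (G : SimpleGraph V) {O : V → Ω → E} (hO : ∀ i, Measurable (O i))
    (hind : ∀ (i : V) (A : Set V), i ∉ A → (∀ j ∈ A, ¬ G.Adj i j) →
      CondIndepFun m hm (O i) (fun ω (j : A) => O j ω) P) {g : V → Ω → ℝ}
    (hg : ∀ i, Measurable[m ⊔ MeasurableSpace.comap (O i) inferInstance] (g i))
    (hsub : ∀ i, IsCondSub m P fun ω => ENNReal.ofReal (Real.exp (g i ω))) :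
    IsCondSub m P fun ω => ENNReal.ofReal (Real.exp ((1 / (deg G : ℝ)) * ∑ i, g i ω)) := by
  classical
  obtain ⟨c, hc⟩ := exists_coloring_deg G
  have hgm : ∀ i, Measurable (g i) := fun i => (hg i).mono (sup_le hm (hO i).comap_le) le_rfl
  -- A colour class contains no edge, so each of its vertices is conditionally independent of any
  -- set of other vertices of the class.
  have hcol : ∀ k : Fin (deg G), IsCondSub m P fun ω =>
      ENNReal.ofReal (Real.exp (∑ i ∈ Finset.univ.filter (fun i => c i = k), g i ω)) := by
    intro k
    have := IsCondSub.prod_of_condIndepFun (P := P) hm hO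
      (fun i => (Real.measurable_exp.comp (hg i)).ennreal_ofReal) hsub
      (Finset.univ.filter (fun i => c i = k)) (fun i hi A hA hiA => hind i A hiA fun j hj hadj => by
        have h1 := hA hj
        simp only [Finset.coe_filter, Finset.mem_univ, true_and, Set.mem_ofPred_eq] at h1
        simp only [Finset.mem_filter, Finset.mem_univ, true_and] at hi
        exact hc i j hadj (hi.trans h1.symm))
    refine this.mono (ae_of_all _ fun ω => ?_)
    simp only [Real.exp_sum, Function.comp]
    rw [ENNReal.ofReal_prod_of_nonneg fun i _ => (Real.exp_pos _).le]
  have := IsCondSub.exp_average hm (deg_pos G)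
    (fun k => Finset.measurable_fun_sum _ fun i _ => hgm i) hcol
  refine this.mono (ae_of_all _ fun ω => ?_)
  have e : ∑ i, g i ω = ∑ k, ∑ i ∈ Finset.univ.filter (fun i => c i = k), g i ω :=
    (Finset.sum_fiberwise _ _ _).symm
  exact (congrArg (fun x => ENNReal.ofReal (Real.exp ((1 / (deg G : ℝ)) * x))) e).le

end DependencyGraph

/-! ### A conditional Bernstein inequality. -/

section Bernstein

variable {Ω : Type*} {m : MeasurableSpace Ω} [mΩ : MeasurableSpace Ω] {P : Measure Ω}
  [IsProbabilityMeasure P]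

/-- A conditional exponential inequality of Bernstein type. -/
theorem isCondSub_exp_centered (hm : m ≤ mΩ) {X : Ω → ℝ} {b b' u : ℝ} (hX : Measurable X)
    (hXb : ∀ ω, |X ω| ≤ b) (hc : ∀ᵐ ω ∂P, |X ω - (P[X | m]) ω| ≤ b') (hu : |u| * b' ≤ 1) :
    IsCondSub m P fun ω => ENNReal.ofReal
      (Real.exp (u * (X ω - (P[X | m]) ω) - u ^ 2 * (P[fun ω => X ω ^ 2 | m]) ω)) := by
  have hXL : MemLp X 2 P := MemLp.of_bound hX.aestronglyMeasurable b (ae_of_all _ hXb)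
  have hXi : Integrable X P := hXL.integrable one_le_two
  have hci : Integrable (P[X | m]) P := integrable_condExp
  have hcm : Measurable[m] (P[X | m]) := stronglyMeasurable_condExp.measurable
  have hqm : Measurable[m] (P[fun ω => X ω ^ 2 | m]) := stronglyMeasurable_condExp.measurable
  set c := P[X | m]
  set q := P[fun ω => X ω ^ 2 | m]
  have hcm' : Measurable c := hcm.mono hm le_rfl
  have hY : Measurable fun ω => u * (X ω - c ω) := (hX.sub hcm').const_mul u
  have hYb : ∀ᵐ ω ∂P, |u * (X ω - c ω)| ≤ 1 := by
    filter_upwards [hc] with ω hω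
    rw [abs_mul]
    exact (mul_le_mul_of_nonneg_left hω (abs_nonneg u)).trans hu
  have hTi : Integrable (fun ω => Real.exp (u * (X ω - c ω))) P := by
    refine Integrable.of_bound hY.exp.aestronglyMeasurable (Real.exp 1) ?_
    filter_upwards [hYb] with ω hω
    rw [Real.norm_eq_abs, Real.abs_exp]
    exact Real.exp_le_exp.2 ((le_abs_self _).trans hω)
  have hsqL : MemLp (X - c) 2 P := hXL.sub (hXL.condExp one_le_two)
  have hsqi : Integrable ((X - c) ^ 2) P := hsqL.integrable_sq
  have hS : P[(fun _ => (1 : ℝ)) + (u • (X - c) + u ^ 2 • (X - c) ^ 2) | m]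
      =ᵐ[P] fun ω => 1 + u ^ 2 * (q ω - c ω ^ 2) := by
    have h1 := condExp_add (m := m) (integrable_const (μ := P) (1 : ℝ))
      (((hXi.sub hci).smul u).add (hsqi.smul (u ^ 2)))
    have h2 := condExp_add (m := m) ((hXi.sub hci).smul u) (hsqi.smul (u ^ 2))
    have h3 := condExp_smul (μ := P) u (X - c) m
    have h4 := condExp_smul (μ := P) (u ^ 2) ((X - c) ^ 2) m
    have h5 := condExp_sub hXi hci m
    have h6 : P[c | m] = c := condExp_of_stronglyMeasurable hm stronglyMeasurable_condExp hci
    have h7 := condVar_ae_eq_condExp_sq_sub_sq_condExp hm hXL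
    have h8 : P[fun _ => (1 : ℝ) | m] = fun _ => 1 := condExp_const hm 1
    filter_upwards [h1, h2, h3, h4, h5, h7] with ω h1 h2 h3 h4 h5 h7
    rw [h1, Pi.add_apply, h2, Pi.add_apply, h3, h4, h8, Pi.smul_apply, Pi.smul_apply, h5,
      Pi.sub_apply, h6]
    have h9 : (P[(X - c) ^ 2 | m]) ω = q ω - c ω ^ 2 := h7
    rw [h9]
    simp [c]
  -- On |y| ≤ 1, exp y ≤ 1 + y + y². The linear term has conditional mean zero, and the conditional
  -- variance q − c² is bounded by the raw second moment q, the quantity the variance condition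
  -- controls.
  have hT : P[fun ω => Real.exp (u * (X ω - c ω)) | m] ≤ᵐ[P] fun ω => 1 + u ^ 2 * q ω := by
    have hle : P[fun ω => Real.exp (u * (X ω - c ω)) | m]
        ≤ᵐ[P] P[(fun _ => (1 : ℝ)) + (u • (X - c) + u ^ 2 • (X - c) ^ 2) | m] := by
      refine condExp_mono hTi ((integrable_const _).add
        (((hXi.sub hci).smul u).add (hsqi.smul (u ^ 2)))) ?_
      filter_upwards [hYb] with ω hω
      have := (abs_le.1 (Real.abs_exp_sub_one_sub_id_le hω)).2
      simp only [Pi.add_apply, Pi.smul_apply, Pi.sub_apply, Pi.pow_apply, smul_eq_mul]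
      nlinarith
    filter_upwards [hle, hS] with ω h1 h2
    rw [h2] at h1
    nlinarith [mul_nonneg (sq_nonneg u) (sq_nonneg (c ω))]
  have hq0 : 0 ≤ᵐ[P] q := condExp_nonneg (ae_of_all _ fun ω => sq_nonneg (X ω))
  have hqm' : Measurable q := hqm.mono hm le_rfl
  intro W hW
  -- The compensator is m-measurable, so it moves into the weight; then 1 + u²q ≤ exp(u²q) cancels
  -- it.
  have hW' : Measurable[m] fun ω => W ω * ENNReal.ofReal (Real.exp (-(u ^ 2 * q ω))) :=
    hW.mul (Real.measurable_exp.comp (hqm.const_mul (u ^ 2)).neg).ennreal_ofReal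
  have key := lintegral_mul_ofReal_le_of_condExp_le hm hY.exp (fun ω => (Real.exp_pos _).le) hTi
    (R := fun ω => 1 + u ^ 2 * q ω) ((hqm'.const_mul (u ^ 2)).const_add 1) hT hW'
  calc _ = ∫⁻ ω, W ω * ENNReal.ofReal (Real.exp (-(u ^ 2 * q ω)))
          * ENNReal.ofReal (Real.exp (u * (X ω - c ω))) ∂P := by
        refine lintegral_congr fun ω => ?_
        rw [mul_assoc, ← ENNReal.ofReal_mul (Real.exp_pos _).le, ← Real.exp_add]
        ring_nf
    _ ≤ _ := key
    _ ≤ ∫⁻ ω, W ω ∂P := by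
        refine lintegral_mono_ae ?_
        filter_upwards [hq0] with ω hω
        rw [mul_assoc, ← ENNReal.ofReal_mul (Real.exp_pos _).le]
        refine mul_le_of_le_one_right' ?_
        rw [ENNReal.ofReal_le_one, Real.exp_neg, inv_mul_le_one₀ (Real.exp_pos _), add_comm]
        exact Real.add_one_le_exp _

end Bernstein

end SuperLearner

namespace SuperLearner

/-! ### Linearity of conditional expectations across several σ-fields. -/

section Linearity

variable {Ω : Type*} {m : MeasurableSpace Ω} [mΩ : MeasurableSpace Ω] {P : Measure Ω}

theorem condExp_linearCombination {f g h : Ω → ℝ} (hf : Integrable f P) (hg : Integrable g P)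
    (hh : Integrable h P) (x y z : ℝ) (m : MeasurableSpace Ω) :
    P[fun ω => x * f ω + y * g ω + z * h ω | m] =ᵐ[P]
      fun ω => x * (P[f | m]) ω + y * (P[g | m]) ω + z * (P[h | m]) ω := by
  have h1 := condExp_add (m := m) ((hf.smul x).add (hg.smul y)) (hh.smul z)
  have h2 := condExp_add (m := m) (hf.smul x) (hg.smul y)
  filter_upwards [h1, h2, condExp_smul (μ := P) x f m, condExp_smul (μ := P) y g m,
    condExp_smul (μ := P) z h m] with ω h1 h2 h3 h4 h5
  have h0 : (P[fun ω => x * f ω + y * g ω + z * h ω | m]) ω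
      = (P[x • f + y • g + z • h | m]) ω := rfl
  rw [h0, h1, Pi.add_apply, h2, Pi.add_apply, h3, h4, h5]
  simp

/-- Three terms suffice because the moment identities of A1 are combined along A² − 2AB + B². -/
theorem condExp_sum_linearCombination {ι : Type*} [Fintype ι]
    {m' : ι → MeasurableSpace Ω} {f g h : ι → Ω → ℝ} (hf : ∀ i, Integrable (f i) P)
    (hg : ∀ i, Integrable (g i) P) (hh : ∀ i, Integrable (h i) P)
    (ef : P[fun ω => ∑ i, f i ω | m] =ᵐ[P] fun ω => ∑ i, (P[f i | m' i]) ω)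
    (eg : P[fun ω => ∑ i, g i ω | m] =ᵐ[P] fun ω => ∑ i, (P[g i | m' i]) ω)
    (eh : P[fun ω => ∑ i, h i ω | m] =ᵐ[P] fun ω => ∑ i, (P[h i | m' i]) ω) (x y z : ℝ) :
    P[fun ω => ∑ i, (x * f i ω + y * g i ω + z * h i ω) | m] =ᵐ[P]
      fun ω => ∑ i, (P[fun ω => x * f i ω + y * g i ω + z * h i ω | m' i]) ω := by
  have h1 := condExp_linearCombination (integrable_finsetSum Finset.univ fun i _ => hf i)
    (integrable_finsetSum Finset.univ fun i _ => hg i)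
    (integrable_finsetSum Finset.univ fun i _ => hh i) x y z m
  have h2 : ∀ᵐ ω ∂P, ∀ i, (P[fun ω => x * f i ω + y * g i ω + z * h i ω | m' i]) ω
      = x * (P[f i | m' i]) ω + y * (P[g i | m' i]) ω + z * (P[h i | m' i]) ω :=
    ae_all_iff.2 fun i => condExp_linearCombination (hf i) (hg i) (hh i) x y z (m' i)
  have h0 : (fun ω => ∑ i, (x * f i ω + y * g i ω + z * h i ω))
      = fun ω => x * ∑ i, f i ω + y * ∑ i, g i ω + z * ∑ i, h i ω := by
    funext ω
    simp only [Finset.sum_add_distrib, Finset.mul_sum]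
  rw [h0]
  filter_upwards [h1, h2, ef, eg, eh] with ω h1 h2 ef eg eh
  rw [h1, Finset.sum_congr rfl fun i _ => h2 i, ef, eg, eh]
  simp only [Finset.sum_add_distrib, Finset.mul_sum]

end Linearity

end SuperLearner

namespace SLModel

open SuperLearner

variable {Ω 𝒜 𝒪 𝒵 Θ : Type*} [mΩ : MeasurableSpace Ω] [MeasurableSpace 𝒪]
  [MeasurableSpace 𝒵] [MeasurableSpace Θ]

/-! ### Measurability with respect to the filtration. -/

section Measurability

variable (M : SLModel Ω 𝒜 𝒪 𝒵 Θ)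

theorem F_mono {s t : ℕ} (h : s ≤ t) : M.F s ≤ M.F t :=
  iSup₂_le fun τ hτ => le_iSup₂_of_le (f := fun τ (_ : τ ∈ Finset.Icc 1 t) =>
    MeasurableSpace.comap (M.obs τ) inferInstance) τ
    (by simp only [Finset.mem_Icc] at hτ ⊢; omega) le_rfl

theorem comap_obs_le_F {t : ℕ} (ht : 1 ≤ t) :
    MeasurableSpace.comap (M.obs t) inferInstance ≤ M.F t :=
  le_iSup₂_of_le (f := fun τ (_ : τ ∈ Finset.Icc 1 t) =>
    MeasurableSpace.comap (M.obs τ) inferInstance) t (by simp [ht]) le_rfl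

theorem measurable_obs_F {t : ℕ} (ht : 1 ≤ t) : Measurable[M.F t] (M.obs t) :=
  (comap_measurable (M.obs t)).mono (M.comap_obs_le_F ht) le_rfl

theorem jointInfo_le_F {t : ℕ} (ht : 1 ≤ t) : M.jointInfo t ≤ M.F t := by
  refine sup_le ?_ (M.F_mono (Nat.sub_le t 1))
  exact (M.measurable_summ.comp (M.measurable_obs_F ht)).comap_le

theorem margInfo_le (α : 𝒜) (t : ℕ) : M.margInfo α t ≤ mΩ :=
  sup_le ((measurable_pi_apply α).comp (M.measurable_Z t)).comap_le (M.F_le (t - 1))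

theorem measurable_output {alg : (t : ℕ) → (Fin t → 𝒜 → 𝒪) → Θ} (h : ∀ t, Measurable (alg t))
    (t : ℕ) : Measurable[M.F t] (M.output alg t) := by
  refine (h t).comp (@measurable_pi_lambda _ _ _ (M.F t) _ _ fun i => ?_)
  exact (M.measurable_obs_F (by omega)).mono (M.F_mono (by omega)) le_rfl

end Measurability

/-! ### Excess losses of an adapted sequence. -/

section Excess

variable (M : SLModel Ω 𝒜 𝒪 𝒵 Θ) (θo : Θ) (ϑ : ℕ → Ω → Θ)

/-- The excess loss at `α` and time `t` of the sequence `ϑ`, which is used one step ahead. -/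
def seqExcess (α : 𝒜) (t : ℕ) (ω : Ω) : ℝ := M.excessAt θo (ϑ (t - 1) ω) α t ω

/-- The average over `𝒜` of the excess losses of the sequence `ϑ`. -/
noncomputable def avgExcess [Fintype 𝒜] (t : ℕ) (ω : Ω) : ℝ :=
  (1 / (Fintype.card 𝒜 : ℝ)) * ∑ α, M.seqExcess θo ϑ α t ω

/-- The conditional expectation of the average excess loss given `(Z̄_t, F_{t-1})`. -/
noncomputable def condAvgExcess [Fintype 𝒜] (P : Measure Ω) (t : ℕ) : Ω → ℝ :=
  P[M.avgExcess θo ϑ t | M.jointInfo t]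

variable {M ϑ}

/-- The parameter and `Z` are known given `M.jointInfo t`, so the only new randomness is that of the
observation at α. This locality lets the dependency graph act on the excess losses. -/
theorem measurable_seqExcess_sup (hϑ : ∀ t, Measurable[M.F t] (ϑ t)) (α : 𝒜) (t : ℕ) :
    Measurable[M.jointInfo t ⊔ MeasurableSpace.comap (fun ω => M.obs t ω α) inferInstance]
      (M.seqExcess θo ϑ α t) := by
  have h1 : Measurable[M.jointInfo t ⊔
      MeasurableSpace.comap (fun ω => M.obs t ω α) inferInstance] (ϑ (t - 1)) :=
    (hϑ (t - 1)).mono (le_sup_right.trans le_sup_left) le_rfl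
  have h2 : Measurable[M.jointInfo t ⊔
      MeasurableSpace.comap (fun ω => M.obs t ω α) inferInstance] (fun ω => M.obs t ω α) :=
    (comap_measurable _).mono le_sup_right le_rfl
  have h3 : Measurable[M.jointInfo t ⊔
      MeasurableSpace.comap (fun ω => M.obs t ω α) inferInstance] (fun ω => M.Z t ω α) :=
    (measurable_pi_apply α).comp
      ((comap_measurable (M.Z t)).mono (le_sup_left.trans le_sup_left) le_rfl)
  exact (M.measurable_loss.comp (h1.prodMk (h2.prodMk h3))).sub
    (M.measurable_loss.comp (measurable_const.prodMk (h2.prodMk h3)))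

theorem measurable_seqExcess_F (hϑ : ∀ t, Measurable[M.F t] (ϑ t)) (α : 𝒜) {t : ℕ} (ht : 1 ≤ t) :
    Measurable[M.F t] (M.seqExcess θo ϑ α t) :=
  (measurable_seqExcess_sup θo hϑ α t).mono (sup_le (M.jointInfo_le_F ht)
    ((measurable_pi_apply α).comp (M.measurable_obs_F ht)).comap_le) le_rfl

theorem measurable_seqExcess (hϑ : ∀ t, Measurable[M.F t] (ϑ t)) (α : 𝒜) (t : ℕ) :
    Measurable (M.seqExcess θo ϑ α t) :=
  (measurable_seqExcess_sup θo hϑ α t).mono (sup_le (M.jointInfo_le t)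
    ((measurable_pi_apply α).comp (M.measurable_obs t)).comap_le) le_rfl

theorem measurable_avgExcess_F [Fintype 𝒜] (hϑ : ∀ t, Measurable[M.F t] (ϑ t)) {t : ℕ}
    (ht : 1 ≤ t) : Measurable[M.F t] (M.avgExcess θo ϑ t) :=
  (Finset.measurable_fun_sum _ fun α _ => measurable_seqExcess_F θo hϑ α ht).const_mul _

theorem measurable_condAvgExcess [Fintype 𝒜] (P : Measure Ω) (t : ℕ) :
    Measurable[M.jointInfo t] (M.condAvgExcess θo ϑ P t) :=
  stronglyMeasurable_condExp.measurable

theorem avgExcess_eq_sub [Fintype 𝒜] (t : ℕ) (ω : Ω) :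
    M.avgExcess θo ϑ t ω = M.avgLoss (ϑ (t - 1) ω) t ω - M.avgLoss θo t ω := by
  simp only [avgExcess, seqExcess, excessAt, avgLoss, Finset.sum_sub_distrib, mul_sub]

end Excess

/-! ### Conditional moments of the excess losses. -/

section Moments

variable [StandardBorelSpace Ω] {M : SLModel Ω 𝒜 𝒪 𝒵 Θ} {P : Measure Ω} [IsProbabilityMeasure P]
  {θs θo : Θ} {b₁ b₂ β γ : ℝ} {ϑ : ℕ → Ω → Θ}

theorem abs_seqExcess_le (hA2 : M.A2 P θo b₁ b₂) (α : 𝒜) (t : ℕ) (ω : Ω) :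
    |M.seqExcess θo ϑ α t ω| ≤ b₁ := hA2.2.1 _ _ _

theorem abs_avgExcess_le [Fintype 𝒜] [Nonempty 𝒜] (hA2 : M.A2 P θo b₁ b₂) (t : ℕ) (ω : Ω) :
    |M.avgExcess θo ϑ t ω| ≤ b₁ := by
  have hc : (0 : ℝ) < Fintype.card 𝒜 := by exact_mod_cast Fintype.card_pos
  rw [avgExcess, abs_mul, abs_of_pos (by positivity), one_div, inv_mul_le_iff₀ hc]
  refine (Finset.abs_sum_le_sum_abs _ _).trans ?_
  refine (Finset.sum_le_card_nsmul _ _ b₁ fun α _ => abs_seqExcess_le hA2 α t ω).trans_eq ?_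
  simp

theorem integrable_avgExcess [Fintype 𝒜] [Nonempty 𝒜] (hA2 : M.A2 P θo b₁ b₂)
    (hϑ : ∀ t, Measurable[M.F t] (ϑ t)) {t : ℕ} (ht : 1 ≤ t) :
    Integrable (M.avgExcess θo ϑ t) P :=
  Integrable.of_bound
    ((measurable_avgExcess_F θo hϑ ht).mono (M.F_le t) le_rfl).aestronglyMeasurable b₁
    (ae_of_all _ fun ω => abs_avgExcess_le hA2 t ω)

theorem integrable_seqExcess_pow (hA2 : M.A2 P θo b₁ b₂)
    (hϑ : ∀ t, Measurable[M.F t] (ϑ t)) (α : 𝒜) (t k : ℕ) :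
    Integrable (fun ω => M.seqExcess θo ϑ α t ω ^ k) P :=
  Integrable.of_bound ((measurable_seqExcess θo hϑ α t).pow_const k).aestronglyMeasurable (b₁ ^ k)
    (ae_of_all _ fun ω => by
      rw [Real.norm_eq_abs, abs_pow]
      exact pow_le_pow_left₀ (abs_nonneg _) (abs_seqExcess_le hA2 α t ω) k)

/-- The conditional moments of the excess loss of the adapted sequence `ϑ` are obtained by
substitution in the conditional moments of the excess losses of constants. -/
theorem condExp_seqExcess_pow (hA2 : M.A2 P θo b₁ b₂)
    (hϑ : ∀ t, Measurable[M.F t] (ϑ t)) (α : 𝒜) (t k : ℕ) :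
    P[fun ω => M.seqExcess θo ϑ α t ω ^ k | M.margInfo α t] =ᵐ[P]
      fun ω => M.condMoment P θo (ϑ (t - 1) ω) α t k ω := by
  have hm := M.margInfo_le α t
  have h1 : Measurable[(M.margInfo α t).prod mΩ] fun p : Ω × Ω => ϑ (t - 1) p.1 :=
    ((hϑ (t - 1)).mono le_sup_right le_rfl).comp (@measurable_fst _ _ (M.margInfo α t) mΩ)
  have h2 : Measurable[(M.margInfo α t).prod mΩ] fun p : Ω × Ω => M.obs t p.2 α :=
    ((measurable_pi_apply α).comp (M.measurable_obs t)).comp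
      (@measurable_snd _ _ (M.margInfo α t) mΩ)
  have h3 : Measurable[(M.margInfo α t).prod mΩ] fun p : Ω × Ω => M.Z t p.2 α :=
    ((measurable_pi_apply α).comp (M.measurable_Z t)).comp
      (@measurable_snd _ _ (M.margInfo α t) mΩ)
  have hψ : Measurable[(M.margInfo α t).prod mΩ]
      fun p : Ω × Ω => M.excessAt θo (ϑ (t - 1) p.1) α t p.2 ^ k :=
    ((M.measurable_loss.comp (h1.prodMk (h2.prodMk h3))).sub
      (M.measurable_loss.comp (measurable_const.prodMk (h2.prodMk h3)))).pow_const k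
  exact condExp_diag_ae_eq_integral_condExpKernel hm hψ (integrable_seqExcess_pow hA2 hϑ α t k)

variable [Fintype 𝒜]

theorem condExp_sum_seqExcess_pow (hA1 : M.A1 P θs) (hA2 : M.A2 P θo b₁ b₂)
    (hϑ : ∀ t, Measurable[M.F t] (ϑ t)) {t : ℕ} (ht : 1 ≤ t) {k : ℕ} (hk : k = 1 ∨ k = 2) :
    P[fun ω => ∑ α, M.seqExcess θo ϑ α t ω ^ k | M.jointInfo t] =ᵐ[P]
      fun ω => ∑ α, (P[fun ω' => M.seqExcess θo ϑ α t ω' ^ k | M.margInfo α t]) ω := by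
  set A : 𝒜 → Ω → ℝ := fun α ω => M.lossAt (ϑ (t - 1) ω) α t ω
  set B : 𝒜 → Ω → ℝ := fun α ω => M.lossAt θo α t ω
  have hX : ∀ α ω, M.seqExcess θo ϑ α t ω = A α ω - B α ω := fun α ω => rfl
  have hB : ∀ α, MemLp (B α) 2 P := fun α => hA1.1 θo α t ht
  -- A1 gives square integrability at constant parameters only; a random parameter is reached by
  -- adding the bounded excess to the loss at `θo`.
  have hA : ∀ α, MemLp (A α) 2 P := fun α => by
    have : MemLp (M.seqExcess θo ϑ α t) 2 P :=
      MemLp.of_bound (measurable_seqExcess θo hϑ α t).aestronglyMeasurable b₁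
        (ae_of_all _ fun ω => abs_seqExcess_le hA2 α t ω)
    have h := this.add (hB α)
    have e : M.seqExcess θo ϑ α t + B α = A α := by
      funext ω; simp [hX]
    rwa [e] at h
  have H := hA1.2.2 θo ϑ hϑ t ht
  rcases hk with rfl | rfl
  -- Only two terms are needed here; the third repeats the second with coefficient 0.
  · have h := condExp_sum_linearCombination (P := P) (f := fun α ω => A α ω ^ 1 * B α ω ^ 0)
      (g := fun α ω => A α ω ^ 0 * B α ω ^ 1) (h := fun α ω => A α ω ^ 0 * B α ω ^ 1)
      (m' := fun α => M.margInfo α t)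
      (fun α => by simpa using (hA α).integrable one_le_two)
      (fun α => by simpa using (hB α).integrable one_le_two)
      (fun α => by simpa using (hB α).integrable one_le_two)
      (H 1 0 (by simp)) (H 0 1 (by simp)) (H 0 1 (by simp)) 1 (-1) 0
    have e : ∀ α ω, (1 : ℝ) * (A α ω ^ 1 * B α ω ^ 0) + (-1) * (A α ω ^ 0 * B α ω ^ 1)
        + 0 * (A α ω ^ 0 * B α ω ^ 1) = M.seqExcess θo ϑ α t ω ^ 1 := fun α ω => by
      rw [hX]; ring
    simpa only [e] using h
  · have h := condExp_sum_linearCombination (P := P) (f := fun α ω => A α ω ^ 2 * B α ω ^ 0)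
      (g := fun α ω => A α ω ^ 1 * B α ω ^ 1) (h := fun α ω => A α ω ^ 0 * B α ω ^ 2)
      (m' := fun α => M.margInfo α t)
      (fun α => by simpa using (hA α).integrable_sq)
      (fun α => by
        simp only [pow_one]
        exact (hA α).integrable_mul (hB α))
      (fun α => by simpa using (hB α).integrable_sq)
      (H 2 0 (by simp)) (H 1 1 (by simp)) (H 0 2 (by simp)) 1 (-2) 1
    have e : ∀ α ω, (1 : ℝ) * (A α ω ^ 2 * B α ω ^ 0) + (-2) * (A α ω ^ 1 * B α ω ^ 1)
        + 1 * (A α ω ^ 0 * B α ω ^ 2) = M.seqExcess θo ϑ α t ω ^ 2 := fun α ω => by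
      rw [hX]; ring
    simpa only [e] using h

end Moments

end SLModel

namespace SLModel

open SuperLearner

variable {Ω 𝒜 𝒪 𝒵 Θ : Type*} [mΩ : MeasurableSpace Ω] [MeasurableSpace 𝒪]
  [MeasurableSpace 𝒵] [MeasurableSpace Θ]

theorem margInfo_le_jointInfo (M : SLModel Ω 𝒜 𝒪 𝒵 Θ) (α : 𝒜) (t : ℕ) :
    M.margInfo α t ≤ M.jointInfo t :=
  sup_le_sup_right (((measurable_pi_apply α).comp (comap_measurable (M.Z t))).comap_le) _

/-! ### From marginal conditions to the exponential supermartingale bound. -/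

section Moments

variable [StandardBorelSpace Ω] {M : SLModel Ω 𝒜 𝒪 𝒵 Θ} {P : Measure Ω} [IsProbabilityMeasure P]
  {θs θo : Θ} {b₁ b₂ β γ : ℝ} {ϑ : ℕ → Ω → Θ}

theorem integrable_seqExcess (hA2 : M.A2 P θo b₁ b₂)
    (hϑ : ∀ t, Measurable[M.F t] (ϑ t)) (α : 𝒜) (t : ℕ) :
    Integrable (M.seqExcess θo ϑ α t) P := by
  simpa using integrable_seqExcess_pow hA2 hϑ α t 1

theorem condExp_seqExcess (hA2 : M.A2 P θo b₁ b₂)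
    (hϑ : ∀ t, Measurable[M.F t] (ϑ t)) (α : 𝒜) (t : ℕ) :
    P[M.seqExcess θo ϑ α t | M.margInfo α t] =ᵐ[P]
      fun ω => M.condMoment P θo (ϑ (t - 1) ω) α t 1 ω := by
  simpa only [pow_one] using condExp_seqExcess_pow hA2 hϑ α t 1

/-- A2 centres at the mean given the marginal information. Conditioning that deviation on the larger
joint σ-field shows the two conditional means differ by at most b₂, whence the factor 2. -/
theorem ae_abs_seqExcess_sub_condExp_le (hA2 : M.A2 P θo b₁ b₂)
    (hϑ : ∀ t, Measurable[M.F t] (ϑ t)) (α : 𝒜) {t : ℕ} (ht : 1 ≤ t) :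
    ∀ᵐ ω ∂P, |M.seqExcess θo ϑ α t ω - (P[M.seqExcess θo ϑ α t | M.jointInfo t]) ω|
      ≤ 2 * b₂ := by
  have hX := integrable_seqExcess hA2 hϑ α t
  set X := M.seqExcess θo ϑ α t
  have h1 : ∀ᵐ ω ∂P, |(X - P[X | M.margInfo α t]) ω| ≤ b₂ := by
    filter_upwards [condExp_seqExcess hA2 hϑ α t, hA2.2.2.2.2] with ω h1 h2
    rw [Pi.sub_apply, h1]
    exact h2 α t ht _
  have h2 := ae_bdd_abs_condExp_of_ae_bdd_abs (m := M.jointInfo t) h1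
  have h3 := condExp_sub hX (integrable_condExp (f := X) (m := M.margInfo α t)) (M.jointInfo t)
  have h4 : P[P[X | M.margInfo α t] | M.jointInfo t] = P[X | M.margInfo α t] :=
    condExp_of_stronglyMeasurable (M.jointInfo_le t)
      (stronglyMeasurable_condExp.mono (M.margInfo_le_jointInfo α t)) integrable_condExp
  filter_upwards [h1, h2, h3] with ω h1 h2 h3
  rw [h3, Pi.sub_apply, h4] at h2
  rw [Pi.sub_apply] at h1
  rw [abs_le] at *
  constructor <;> linarith [h1.1, h1.2, h2.1, h2.2]

variable [Fintype 𝒜]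

/-- This form gives access to A3, which concerns marginal conditional moments; the joint form that
follows supplies the centring used in the Bernstein factors. -/
theorem condAvgExcess_ae_eq_margin (hA1 : M.A1 P θs) (hA2 : M.A2 P θo b₁ b₂)
    (hϑ : ∀ t, Measurable[M.F t] (ϑ t)) {t : ℕ} (ht : 1 ≤ t) :
    M.condAvgExcess θo ϑ P t =ᵐ[P] fun ω => (1 / (Fintype.card 𝒜 : ℝ)) *
      ∑ α, M.condMoment P θo (ϑ (t - 1) ω) α t 1 ω := by
  have h1 := condExp_smul (μ := P) (1 / (Fintype.card 𝒜 : ℝ))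
    (fun ω => ∑ α, M.seqExcess θo ϑ α t ω) (M.jointInfo t)
  have h2 := condExp_sum_seqExcess_pow hA1 hA2 hϑ ht (k := 1) (Or.inl rfl)
  have h3 : ∀ᵐ ω ∂P, ∀ α, (P[M.seqExcess θo ϑ α t | M.margInfo α t]) ω
      = M.condMoment P θo (ϑ (t - 1) ω) α t 1 ω :=
    ae_all_iff.2 fun α => condExp_seqExcess hA2 hϑ α t
  simp only [pow_one] at h2
  filter_upwards [h1, h2, h3] with ω h1 h2 h3
  refine h1.trans ?_
  rw [Pi.smul_apply, h2, smul_eq_mul, Finset.sum_congr rfl fun α _ => h3 α]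

theorem condAvgExcess_ae_eq_joint (hA2 : M.A2 P θo b₁ b₂)
    (hϑ : ∀ t, Measurable[M.F t] (ϑ t)) (t : ℕ) :
    M.condAvgExcess θo ϑ P t =ᵐ[P] fun ω => (1 / (Fintype.card 𝒜 : ℝ)) *
      ∑ α, (P[M.seqExcess θo ϑ α t | M.jointInfo t]) ω := by
  have h1 := condExp_smul (μ := P) (1 / (Fintype.card 𝒜 : ℝ))
    (∑ α, M.seqExcess θo ϑ α t) (M.jointInfo t)
  have h2 := condExp_finsetSum (s := Finset.univ)
    (fun α _ => integrable_seqExcess (P := P) hA2 hϑ α t) (M.jointInfo t)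
  have e : M.avgExcess θo ϑ t = (1 / (Fintype.card 𝒜 : ℝ)) • ∑ α, M.seqExcess θo ϑ α t := by
    funext ω
    simp [avgExcess]
  unfold condAvgExcess
  rw [e]
  filter_upwards [h1, h2] with ω h1 h2
  rw [h1, Pi.smul_apply, h2, smul_eq_mul, Finset.sum_apply]

theorem condAvgExcess_nonneg (hA1 : M.A1 P θs) (hA2 : M.A2 P θo b₁ b₂) (hA3 : M.A3 P θo β γ)
    (hϑ : ∀ t, Measurable[M.F t] (ϑ t)) {t : ℕ} (ht : 1 ≤ t) :
    ∀ᵐ ω ∂P, 0 ≤ M.condAvgExcess θo ϑ P t ω := by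
  filter_upwards [condAvgExcess_ae_eq_margin hA1 hA2 hϑ ht, hA3.2.2.2] with ω h1 h2
  rw [h1]
  exact mul_nonneg (by positivity) (Finset.sum_nonneg fun α _ => (h2 α t ht _).1)

variable [Nonempty 𝒜]

/-- A1 turns the sum of joint second moments into a sum of marginal ones, A3 bounds each, and
concavity of x ↦ x^β moves the average inside the power. -/
theorem sum_condExp_sq_le (hA1 : M.A1 P θs) (hA2 : M.A2 P θo b₁ b₂) (hA3 : M.A3 P θo β γ)
    (hϑ : ∀ t, Measurable[M.F t] (ϑ t)) {t : ℕ} (ht : 1 ≤ t) :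
    ∀ᵐ ω ∂P, ∑ α, (P[fun ω => M.seqExcess θo ϑ α t ω ^ 2 | M.jointInfo t]) ω
      ≤ Fintype.card 𝒜 * (γ * M.condAvgExcess θo ϑ P t ω ^ β) := by
  have h1 := condExp_finsetSum (s := Finset.univ)
    (fun α _ => integrable_seqExcess_pow (P := P) hA2 hϑ α t 2) (M.jointInfo t)
  have h2 := condExp_sum_seqExcess_pow hA1 hA2 hϑ ht (k := 2) (Or.inr rfl)
  have h3 : ∀ᵐ ω ∂P, ∀ α, (P[fun ω => M.seqExcess θo ϑ α t ω ^ 2 | M.margInfo α t]) ω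
      = M.condMoment P θo (ϑ (t - 1) ω) α t 2 ω :=
    ae_all_iff.2 fun α => condExp_seqExcess_pow hA2 hϑ α t 2
  have e : (∑ α, fun ω => M.seqExcess θo ϑ α t ω ^ 2)
      = fun ω => ∑ α, M.seqExcess θo ϑ α t ω ^ 2 := by
    funext ω; simp
  rw [e] at h1
  filter_upwards [h1, h2, h3, condAvgExcess_ae_eq_margin hA1 hA2 hϑ ht, hA3.2.2.2]
    with ω h1 h2 h3 h4 h5
  rw [Finset.sum_apply] at h1
  rw [← h1, h2, Finset.sum_congr rfl fun α _ => h3 α, h4]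
  have hc : (0 : ℝ) < Fintype.card 𝒜 := by exact_mod_cast Fintype.card_pos
  have hj := (Real.concaveOn_rpow hA3.1.le hA3.2.1).le_map_sum (t := Finset.univ)
    (w := fun _ : 𝒜 => 1 / (Fintype.card 𝒜 : ℝ))
    (p := fun α => M.condMoment P θo (ϑ (t - 1) ω) α t 1 ω)
    (fun _ _ => by positivity) (by simp) (fun α _ => (h5 α t ht _).1)
  simp only [smul_eq_mul, ← Finset.mul_sum] at hj
  calc ∑ α, M.condMoment P θo (ϑ (t - 1) ω) α t 2 ω
      ≤ ∑ α, γ * M.condMoment P θo (ϑ (t - 1) ω) α t 1 ω ^ β :=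
        Finset.sum_le_sum fun α _ => (h5 α t ht _).2
    _ = Fintype.card 𝒜 * (γ * (1 / (Fintype.card 𝒜 : ℝ) *
          ∑ α, M.condMoment P θo (ϑ (t - 1) ω) α t 1 ω ^ β)) := by
        rw [← Finset.mul_sum]; field_simp
    _ ≤ _ := by
        have := hA3.2.2.1.le
        gcongr

/-- One-step exponential inequality for the average excess loss. -/
theorem isCondSub_exp_avgExcess {G : SimpleGraph 𝒜} (hA0 : M.A0 P G) (hA1 : M.A1 P θs)
    (hA2 : M.A2 P θo b₁ b₂) (hA3 : M.A3 P θo β γ) (hϑ : ∀ t, Measurable[M.F t] (ϑ t))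
    {t : ℕ} (ht : 1 ≤ t) {l : ℝ} (hl : |l| * (2 * b₂) ≤ ratio G) :
    IsCondSub (M.jointInfo t) P fun ω => ENNReal.ofReal (Real.exp
      (l * (M.avgExcess θo ϑ t ω - M.condAvgExcess θo ϑ P t ω)
        - l ^ 2 * γ / ratio G * M.condAvgExcess θo ϑ P t ω ^ β)) := by
  have hr : 0 < ratio G := zero_lt_one.trans_le (one_le_ratio G)
  have hc : (0 : ℝ) < Fintype.card 𝒜 := by exact_mod_cast Fintype.card_pos
  have hd : (0 : ℝ) < deg G := by exact_mod_cast deg_pos G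
  -- With this scale, u/`deg G` = l/|𝒜|, so the graph bound yields exactly l times the average, and
  -- the variance coefficient becomes l²/r.
  set u : ℝ := l / ratio G with hu
  have hub : |u| * (2 * b₂) ≤ 1 := by
    rw [hu, abs_div, abs_of_pos hr, div_mul_eq_mul_div, div_le_one hr]
    exact hl
  have hcm : ∀ α, Measurable[M.jointInfo t] (P[M.seqExcess θo ϑ α t | M.jointInfo t]) :=
    fun α => stronglyMeasurable_condExp.measurable
  have hqm : ∀ α, Measurable[M.jointInfo t]
      (P[fun ω => M.seqExcess θo ϑ α t ω ^ 2 | M.jointInfo t]) :=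
    fun α => stronglyMeasurable_condExp.measurable
  have hle : ∀ α, M.jointInfo t ≤
      M.jointInfo t ⊔ MeasurableSpace.comap (fun ω => M.obs t ω α) inferInstance :=
    fun _ => le_sup_left
  have hg : ∀ α, Measurable[M.jointInfo t ⊔
      MeasurableSpace.comap (fun ω => M.obs t ω α) inferInstance] fun ω =>
      u * (M.seqExcess θo ϑ α t ω - (P[M.seqExcess θo ϑ α t | M.jointInfo t]) ω)
        - u ^ 2 * (P[fun ω => M.seqExcess θo ϑ α t ω ^ 2 | M.jointInfo t]) ω := by
    intro α
    have h1 := (hcm α).mono (hle α) le_rfl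
    have h2 := (hqm α).mono (hle α) le_rfl
    exact (((measurable_seqExcess_sup θo hϑ α t).sub h1).const_mul u).sub (h2.const_mul (u ^ 2))
  have key := IsCondSub.exp_sum_of_dependencyGraph (P := P) (M.jointInfo_le t) G
    (O := fun α ω => M.obs t ω α) (fun α => (measurable_pi_apply α).comp (M.measurable_obs t))
    (fun α A' h1 h2 => hA0 t ht α A' h1 h2)
    (g := fun α ω => u * (M.seqExcess θo ϑ α t ω
        - (P[M.seqExcess θo ϑ α t | M.jointInfo t]) ω)
      - u ^ 2 * (P[fun ω => M.seqExcess θo ϑ α t ω ^ 2 | M.jointInfo t]) ω)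
    hg
    (fun α => isCondSub_exp_centered (M.jointInfo_le t) (measurable_seqExcess θo hϑ α t)
      (fun ω => abs_seqExcess_le hA2 α t ω) (ae_abs_seqExcess_sub_condExp_le hA2 hϑ α ht) hub)
  refine key.mono ?_
  filter_upwards [condAvgExcess_ae_eq_joint (P := P) hA2 hϑ t, sum_condExp_sq_le hA1 hA2 hA3 hϑ ht]
    with ω h1 h2
  refine ENNReal.ofReal_le_ofReal (Real.exp_le_exp.2 ?_)
  rw [Finset.sum_sub_distrib, ← Finset.mul_sum, ← Finset.mul_sum, Finset.sum_sub_distrib]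
  have e1 : 1 / (deg G : ℝ) * (u * (∑ α, M.seqExcess θo ϑ α t ω
      - ∑ α, (P[M.seqExcess θo ϑ α t | M.jointInfo t]) ω))
      = l * (M.avgExcess θo ϑ t ω - M.condAvgExcess θo ϑ P t ω) := by
    rw [h1, avgExcess, hu, ratio]
    field_simp
  have e2 : 1 / (deg G : ℝ) * (u ^ 2 *
        ∑ α, (P[fun ω => M.seqExcess θo ϑ α t ω ^ 2 | M.jointInfo t]) ω)
      ≤ l ^ 2 * γ / ratio G * M.condAvgExcess θo ϑ P t ω ^ β :=
    calc _ ≤ 1 / (deg G : ℝ) * (u ^ 2 *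
          (Fintype.card 𝒜 * (γ * M.condAvgExcess θo ϑ P t ω ^ β))) := by
          gcongr
      _ = _ := by
          rw [hu, ratio]
          field_simp
  rw [← e1, mul_sub (1 / (deg G : ℝ))]
  exact sub_le_sub_left e2 _

/-- The exponential supermartingale bound. -/
theorem lintegral_exp_sum_avgExcess_le {G : SimpleGraph 𝒜} (hA0 : M.A0 P G) (hA1 : M.A1 P θs)
    (hA2 : M.A2 P θo b₁ b₂) (hA3 : M.A3 P θo β γ) (hϑ : ∀ t, Measurable[M.F t] (ϑ t))
    {l : ℝ} (hl : |l| * (2 * b₂) ≤ ratio G) (n : ℕ) :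
    ∫⁻ ω, ENNReal.ofReal (Real.exp (∑ τ ∈ Finset.Icc 1 n,
      (l * (M.avgExcess θo ϑ τ ω - M.condAvgExcess θo ϑ P τ ω)
        - l ^ 2 * γ / ratio G * M.condAvgExcess θo ϑ P τ ω ^ β))) ∂P ≤ 1 := by
  induction n with
  | zero => simp
  | succ n ih =>
    refine le_trans ?_ ih
    -- All earlier terms are known given `M.jointInfo (n + 1)`, so their exponential serves as the
    -- weight when the last factor is removed.
    have hmeas : ∀ τ ∈ Finset.Icc 1 n, Measurable[M.jointInfo (n + 1)] fun ω =>
        (l * (M.avgExcess θo ϑ τ ω - M.condAvgExcess θo ϑ P τ ω)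
          - l ^ 2 * γ / ratio G * M.condAvgExcess θo ϑ P τ ω ^ β) := by
      intro τ hτ
      rw [Finset.mem_Icc] at hτ
      have hle : M.F τ ≤ M.jointInfo (n + 1) := (M.F_mono hτ.2).trans le_sup_right
      have h1 := (measurable_avgExcess_F θo hϑ hτ.1).mono hle le_rfl
      have h2 := (measurable_condAvgExcess (M := M) (ϑ := ϑ) θo P τ).mono
        ((M.jointInfo_le_F hτ.1).trans hle) le_rfl
      exact ((h1.sub h2).const_mul l).sub ((h2.pow_const β).const_mul _)
    have h := isCondSub_exp_avgExcess hA0 hA1 hA2 hA3 hϑ (Nat.le_add_left 1 n) hl _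
      (Real.measurable_exp.comp (Finset.measurable_fun_sum _ hmeas)).ennreal_ofReal
    refine le_trans (le_of_eq (lintegral_congr fun ω => ?_)) h
    rw [Finset.sum_Icc_succ_top (Nat.le_add_left 1 n), Real.exp_add,
      ENNReal.ofReal_mul (Real.exp_pos _).le]
    rfl

end Moments

end SLModel

/-! ### Random indices and scalar inequalities. -/

namespace SuperLearner

theorem integrable_exp_of_lintegral_le_one {Ω : Type*} [MeasurableSpace Ω] {P : Measure Ω}
    {g : Ω → ℝ} (hg : Measurable g) (h : ∫⁻ ω, ENNReal.ofReal (Real.exp (g ω)) ∂P ≤ 1) :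
    Integrable (fun ω => Real.exp (g ω)) P ∧ ∫ ω, Real.exp (g ω) ∂P ≤ 1 := by
  constructor
  · refine ⟨hg.exp.aestronglyMeasurable, ?_⟩
    rw [hasFiniteIntegral_iff_ofReal (ae_of_all _ fun ω => (Real.exp_pos _).le)]
    exact h.trans_lt ENNReal.one_lt_top
  · rw [integral_eq_lintegral_of_nonneg_ae (ae_of_all _ fun ω => (Real.exp_pos _).le)
      hg.exp.aestronglyMeasurable]
    exact ENNReal.toReal_le_of_le_ofReal zero_le_one (by simpa using h)

theorem integrable_select {Ω : Type*} [MeasurableSpace Ω] {P : Measure Ω} {J : ℕ}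
    {H : Fin J → Ω → ℝ} (hH : ∀ j, Integrable (H j) P) {idx : Ω → Fin J} (hidx : Measurable idx) :
    Integrable (fun ω => H (idx ω) ω) P := by
  have e : (fun ω => H (idx ω) ω) = fun ω => ∑ j, (idx ⁻¹' {j}).indicator (H j) ω := by
    funext ω
    rw [Finset.sum_eq_single (idx ω)]
    · rw [Set.indicator_of_mem (by simp)]
    · intro j _ hj
      rw [Set.indicator_of_notMem]
      simpa using hj.symm
    · simp
  rw [e]
  exact integrable_finsetSum _ fun j _ => (hH j).indicator (hidx (measurableSet_singleton j))

/-- This is log x ≤ x − 1 at x = exp(g i)/J. The right side does not depend on i, so a random index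
may be inserted before taking expectations. -/
theorem le_log_card_sub_one_add_sum_exp {J : ℕ} (hJ : 0 < J) (g : Fin J → ℝ) (i : Fin J) :
    g i ≤ Real.log J - 1 + (1 / (J : ℝ)) * ∑ j, Real.exp (g j) := by
  have hJ' : (0 : ℝ) < J := by exact_mod_cast hJ
  have h1 : Real.exp (g i) ≤ ∑ j, Real.exp (g j) :=
    Finset.single_le_sum (f := fun j => Real.exp (g j)) (fun j _ => (Real.exp_pos _).le)
      (Finset.mem_univ i)
  have h2 := Real.log_le_sub_one_of_pos (div_pos (Real.exp_pos (g i)) hJ')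
  rw [Real.log_div (Real.exp_pos _).ne' hJ'.ne', Real.log_exp] at h2
  have h3 : Real.exp (g i) / J ≤ (1 / (J : ℝ)) * ∑ j, Real.exp (g j) := by
    rw [one_div, div_eq_inv_mul]
    gcongr
  linarith

/-- Weighted AM–GM, with the weights β and 1 − β then bounded by 1. The free scale s trades a
multiple of the risk against a constant. -/
theorem rpow_mul_rpow_one_sub_le {h s β : ℝ} (hh : 0 ≤ h) (hs : 0 ≤ s) (h0 : 0 ≤ β) (h1 : β ≤ 1) :
    s ^ (1 - β) * h ^ β ≤ h + s := by
  have := Real.geom_mean_le_arith_mean2_weighted h0 (sub_nonneg.2 h1) hh hs (by ring)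
  nlinarith [mul_nonneg h0 hs, mul_nonneg (sub_nonneg.2 h1) hh]

end SuperLearner

namespace SLModel

open SuperLearner

variable {Ω 𝒜 𝒪 𝒵 Θ : Type*} [mΩ : MeasurableSpace Ω] [MeasurableSpace 𝒪]
  [MeasurableSpace 𝒵] [MeasurableSpace Θ]

/-! ### Regret as an average of conditional excess losses. -/

section Risk

variable {M : SLModel Ω 𝒜 𝒪 𝒵 Θ} {P : Measure Ω} [IsProbabilityMeasure P]
  [StandardBorelSpace Ω] [Fintype 𝒜] [Nonempty 𝒜] {θs θo : Θ} {b₁ b₂ : ℝ} {ϑ : ℕ → Ω → Θ}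

theorem risk_sub_constRisk_ae_eq (hA1 : M.A1 P θs) (hA2 : M.A2 P θo b₁ b₂)
    (hϑ : ∀ t, Measurable[M.F t] (ϑ t)) (t : ℕ) :
    ∀ᵐ ω ∂P, M.risk P ϑ t ω - M.constRisk P θo t ω
      = (1 / (t : ℝ)) * ∑ τ ∈ Finset.Icc 1 t, M.condAvgExcess θo ϑ P τ ω := by
  have h : ∀ τ ∈ Finset.Icc 1 t, ∀ᵐ ω ∂P, M.condAvgExcess θo ϑ P τ ω =
      (P[fun ω' => M.avgLoss (ϑ (τ - 1) ω') τ ω' | M.jointInfo τ]) ω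
        - (P[fun ω' => M.avgLoss θo τ ω' | M.jointInfo τ]) ω := by
    intro τ hτ
    have hτ1 := (Finset.mem_Icc.1 hτ).1
    have hB : Integrable (fun ω' => M.avgLoss θo τ ω') P :=
      (integrable_finsetSum _ fun α _ => (hA1.1 θo α τ hτ1).integrable one_le_two).const_mul _
    have hX := integrable_avgExcess hA2 hϑ hτ1
    have hA : Integrable (fun ω' => M.avgLoss (ϑ (τ - 1) ω') τ ω') P := by
      refine (hX.add hB).congr (ae_of_all _ fun ω => ?_)
      simp [avgExcess_eq_sub]
    have e : M.avgExcess θo ϑ τ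
        = (fun ω' => M.avgLoss (ϑ (τ - 1) ω') τ ω') - fun ω' => M.avgLoss θo τ ω' := by
      funext ω
      rw [avgExcess_eq_sub, Pi.sub_apply]
    unfold condAvgExcess
    rw [e]
    exact condExp_sub hA hB _
  filter_upwards [(Finset.eventually_all _).2 h] with ω hω
  rw [constRisk, risk, risk, ← mul_sub, ← Finset.sum_sub_distrib, Finset.sum_congr rfl hω]

theorem integrable_risk_sub_constRisk (hA1 : M.A1 P θs) (hA2 : M.A2 P θo b₁ b₂)
    (hϑ : ∀ t, Measurable[M.F t] (ϑ t)) (t : ℕ) :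
    Integrable (fun ω => M.risk P ϑ t ω - M.constRisk P θo t ω) P := by
  refine Integrable.congr ?_
    ((risk_sub_constRisk_ae_eq hA1 hA2 hϑ t).mono fun _ h => h.symm)
  exact (integrable_finsetSum _ fun τ _ => integrable_condExp).const_mul _

end Risk

/-! ### Pathwise inequalities. -/

section Deterministic

variable {M : SLModel Ω 𝒜 𝒪 𝒵 Θ} {P : Measure Ω} [Fintype 𝒜] {θo : Θ} {β : ℝ} {ϑ : ℕ → Ω → Θ}
  {t : ℕ}

theorem empRisk_sub (t : ℕ) (ω : Ω) :
    M.empRisk ϑ t ω - M.empRisk (fun _ _ => θo) t ω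
      = (1 / (t : ℝ)) * ∑ τ ∈ Finset.Icc 1 t, M.avgExcess θo ϑ τ ω := by
  rw [empRisk, empRisk, ← mul_sub, ← Finset.sum_sub_distrib]
  simp only [avgExcess_eq_sub]

/-- The exponent in the exponential inequality for the cumulated excess losses. -/
noncomputable def cumExponent (M : SLModel Ω 𝒜 𝒪 𝒵 Θ) (P : Measure Ω) (θo : Θ) (ϑ : ℕ → Ω → Θ)
    (β c l : ℝ) (t : ℕ) (ω : Ω) : ℝ :=
  ∑ τ ∈ Finset.Icc 1 t, (l * (M.avgExcess θo ϑ τ ω - M.condAvgExcess θo ϑ P τ ω)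
    - l ^ 2 * c * M.condAvgExcess θo ϑ P τ ω ^ β)

theorem measurable_cumExponent (hϑ : ∀ t, Measurable[M.F t] (ϑ t)) (c l : ℝ) :
    Measurable (M.cumExponent P θo ϑ β c l t) := by
  refine Finset.measurable_fun_sum _ fun τ hτ => ?_
  have h1 := (measurable_avgExcess_F θo hϑ (Finset.mem_Icc.1 hτ).1).mono (M.F_le τ) le_rfl
  have h2 := (measurable_condAvgExcess (M := M) (ϑ := ϑ) θo P τ).mono (M.jointInfo_le τ) le_rfl
  exact ((h1.sub h2).const_mul l).sub ((h2.pow_const β).const_mul _)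

/-- The linear bound of the cumulated deviation by the exponent. -/
theorem mul_sum_sub_le_cumExponent {c l K s : ℝ} (hβ0 : 0 ≤ β) (hβ1 : β ≤ 1)
    (hs : 0 ≤ s) (hK : 0 ≤ K) (hlK : |l| * c ≤ K * s ^ (1 - β)) {ω : Ω}
    (hω : ∀ τ ∈ Finset.Icc 1 t, 0 ≤ M.condAvgExcess θo ϑ P τ ω) :
    l * (∑ τ ∈ Finset.Icc 1 t, M.avgExcess θo ϑ τ ω
        - ∑ τ ∈ Finset.Icc 1 t, M.condAvgExcess θo ϑ P τ ω)
      ≤ M.cumExponent P θo ϑ β c l t ω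
        + |l| * K * (∑ τ ∈ Finset.Icc 1 t, M.condAvgExcess θo ϑ P τ ω + t * s) := by
  have e : ((t : ℝ) * s) = ∑ _τ ∈ Finset.Icc 1 t, s := by simp
  rw [e, ← Finset.sum_sub_distrib, ← Finset.sum_add_distrib, Finset.mul_sum, Finset.mul_sum,
    cumExponent, ← Finset.sum_add_distrib]
  refine Finset.sum_le_sum fun τ hτ => ?_
  have h0 := hω τ hτ
  have h1 := rpow_mul_rpow_one_sub_le h0 hs hβ0 hβ1
  have h2 : l ^ 2 * c * M.condAvgExcess θo ϑ P τ ω ^ β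
      ≤ |l| * K * (M.condAvgExcess θo ϑ P τ ω + s) := by
    calc l ^ 2 * c * M.condAvgExcess θo ϑ P τ ω ^ β
        = |l| * (|l| * c) * M.condAvgExcess θo ϑ P τ ω ^ β := by rw [← sq_abs]; ring
      _ ≤ |l| * (K * s ^ (1 - β)) * M.condAvgExcess θo ϑ P τ ω ^ β := by
          gcongr
      _ = |l| * K * (s ^ (1 - β) * M.condAvgExcess θo ϑ P τ ω ^ β) := by ring
      _ ≤ _ := by gcongr
  linarith

end Deterministic

/-! ### The oracle inequality and its tuning. -/

section Oracle

variable [StandardBorelSpace Ω] {M : SLModel Ω 𝒜 𝒪 𝒵 Θ} {P : Measure Ω} [IsProbabilityMeasure P]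
  [Fintype 𝒜] [Nonempty 𝒜] {G : SimpleGraph 𝒜} {θs θo : Θ} {b₁ b₂ β γ : ℝ}
  {J : ℕ} {ϑ : Fin J → ℕ → Ω → Θ} {t : ℕ} {jhat jtilde : Ω → Fin J} {a : ℝ}

theorem exp_cumExponent_integral_le (hA0 : M.A0 P G) (hA1 : M.A1 P θs)
    (hA2 : M.A2 P θo b₁ b₂) (hA3 : M.A3 P θo β γ) {ϑ : ℕ → Ω → Θ}
    (hϑ : ∀ t, Measurable[M.F t] (ϑ t)) {l : ℝ} (hl : |l| * (2 * b₂) ≤ ratio G) :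
    Integrable (fun ω => Real.exp (M.cumExponent P θo ϑ β (γ / ratio G) l t ω)) P ∧
      ∫ ω, Real.exp (M.cumExponent P θo ϑ β (γ / ratio G) l t ω) ∂P ≤ 1 := by
  refine integrable_exp_of_lintegral_le_one (measurable_cumExponent hϑ _ l) ?_
  have := lintegral_exp_sum_avgExcess_le hA0 hA1 hA2 hA3 hϑ hl t
  simpa only [cumExponent, mul_div_assoc] using this

theorem integral_regret_le_of_tuning (hA0 : M.A0 P G) (hA1 : M.A1 P θs)
    (hA2 : M.A2 P θo b₁ b₂) (hA3 : M.A3 P θo β γ) (hϑ : ∀ j t, Measurable[M.F t] (ϑ j t))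
    (ht : 1 ≤ t) (hjhat_meas : Measurable jhat) (hjtilde_meas : Measurable jtilde)
    (hjhat : ∀ᵐ ω ∂P, ∀ j, M.empRisk (ϑ (jhat ω)) t ω ≤ M.empRisk (ϑ j) t ω)
    (ha : 0 < a) {l s : ℝ} (hl : 0 < l) (hs : 0 ≤ s) (hlb : l * (2 * b₂) ≤ ratio G)
    (hlK : l * (γ / ratio G) ≤ a / (1 + a) * s ^ (1 - β)) :
    ∫ ω, (M.risk P (ϑ (jhat ω)) t ω - M.constRisk P θo t ω
        - (1 + 2 * a) * (M.risk P (ϑ (jtilde ω)) t ω - M.constRisk P θo t ω)) ∂P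
      ≤ 2 * (1 + a) / t * (Real.log J / l) + 2 * a * s := by
  have ht' : (0 : ℝ) < t := by exact_mod_cast ht
  obtain ⟨ω₀⟩ : Nonempty Ω := nonempty_of_isProbabilityMeasure P
  have hJ : 0 < J := (Nat.zero_le _).trans_lt (jhat ω₀).isLt
  have hJ' : (0 : ℝ) < J := by exact_mod_cast hJ
  set c := γ / ratio G with hc
  set gp : Fin J → Ω → ℝ := fun j => M.cumExponent P θo (ϑ j) β c l t with hgp
  set gm : Fin J → Ω → ℝ := fun j => M.cumExponent P θo (ϑ j) β c (-l) t with hgm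
  have hp : ∀ j, Integrable (fun ω => Real.exp (gp j ω)) P ∧ ∫ ω, Real.exp (gp j ω) ∂P ≤ 1 :=
    fun j => exp_cumExponent_integral_le hA0 hA1 hA2 hA3 (hϑ j) (by rwa [abs_of_pos hl])
  have hm : ∀ j, Integrable (fun ω => Real.exp (gm j ω)) P ∧ ∫ ω, Real.exp (gm j ω) ∂P ≤ 1 :=
    fun j => exp_cumExponent_integral_le hA0 hA1 hA2 hA3 (hϑ j) (by rwa [abs_neg, abs_of_pos hl])
  set V : Ω → ℝ := fun ω => (1 + a) / (t * l) * (2 * Real.log J - 2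
      + 1 / (J : ℝ) * (∑ j, Real.exp (gp j ω) + ∑ j, Real.exp (gm j ω))) + 2 * a * s with hV
  have hsump : Integrable (fun ω => ∑ j, Real.exp (gp j ω)) P :=
    integrable_finsetSum _ fun j _ => (hp j).1
  have hsumm : Integrable (fun ω => ∑ j, Real.exp (gm j ω)) P :=
    integrable_finsetSum _ fun j _ => (hm j).1
  have hVi : Integrable V P :=
    (((integrable_const _).add ((hsump.add hsumm).const_mul _)).const_mul _).add (integrable_const _)
  have hUi : Integrable (fun ω => M.risk P (ϑ (jhat ω)) t ω - M.constRisk P θo t ω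
      - (1 + 2 * a) * (M.risk P (ϑ (jtilde ω)) t ω - M.constRisk P θo t ω)) P :=
    (integrable_select (fun j => integrable_risk_sub_constRisk hA1 hA2 (hϑ j) t) hjhat_meas).sub
      ((integrable_select (fun j => integrable_risk_sub_constRisk hA1 hA2 (hϑ j) t)
        hjtilde_meas).const_mul _)
  have hle : ∀ᵐ ω ∂P, M.risk P (ϑ (jhat ω)) t ω - M.constRisk P θo t ω
      - (1 + 2 * a) * (M.risk P (ϑ (jtilde ω)) t ω - M.constRisk P θo t ω) ≤ V ω := by
    have h1 : ∀ᵐ ω ∂P, ∀ j, M.risk P (ϑ j) t ω - M.constRisk P θo t ω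
        = (1 / (t : ℝ)) * ∑ τ ∈ Finset.Icc 1 t, M.condAvgExcess θo (ϑ j) P τ ω :=
      ae_all_iff.2 fun j => risk_sub_constRisk_ae_eq hA1 hA2 (hϑ j) t
    have h2 : ∀ᵐ ω ∂P, ∀ j, ∀ τ ∈ Finset.Icc 1 t, 0 ≤ M.condAvgExcess θo (ϑ j) P τ ω :=
      ae_all_iff.2 fun j => (Finset.eventually_all _).2 fun τ hτ =>
        condAvgExcess_nonneg hA1 hA2 hA3 (hϑ j) (Finset.mem_Icc.1 hτ).1
    filter_upwards [h1, h2, hjhat] with ω h1 h2 h3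
    have hK : 0 ≤ a / (1 + a) := by positivity
    have h4 := mul_sum_sub_le_cumExponent hA3.1.le hA3.2.1 hs hK
      (by rwa [abs_of_pos hl]) (h2 (jtilde ω))
    have h5 := mul_sum_sub_le_cumExponent (l := -l) hA3.1.le hA3.2.1 hs hK
      (by rwa [abs_neg, abs_of_pos hl]) (h2 (jhat ω))
    have h6 := h3 (jtilde ω)
    have h7 := empRisk_sub (M := M) (ϑ := ϑ (jtilde ω)) (θo := θo) t ω
    have h8 := empRisk_sub (M := M) (ϑ := ϑ (jhat ω)) (θo := θo) t ω
    have h9 := le_log_card_sub_one_add_sum_exp hJ (fun j => gp j ω) (jtilde ω)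
    have h10 := le_log_card_sub_one_add_sum_exp hJ (fun j => gm j ω) (jhat ω)
    rw [h1, h1]
    rw [abs_neg, abs_of_pos hl] at h5
    rw [abs_of_pos hl] at h4
    change _ ≤ gp (jtilde ω) ω + _ at h4
    change _ ≤ gm (jhat ω) ω + _ at h5
    set St := ∑ τ ∈ Finset.Icc 1 t, M.condAvgExcess θo (ϑ (jtilde ω)) P τ ω
    set Sh := ∑ τ ∈ Finset.Icc 1 t, M.condAvgExcess θo (ϑ (jhat ω)) P τ ω
    set Et := ∑ τ ∈ Finset.Icc 1 t, M.avgExcess θo (ϑ (jtilde ω)) τ ω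
    set Eh := ∑ τ ∈ Finset.Icc 1 t, M.avgExcess θo (ϑ (jhat ω)) τ ω
    have hE : Eh ≤ Et := by
      have : 1 / (t : ℝ) * Eh ≤ 1 / (t : ℝ) * Et := by rw [← h7, ← h8]; linarith
      exact le_of_mul_le_mul_left this (by positivity)
    have hsum : gp (jtilde ω) ω + gm (jhat ω) ω ≤ 2 * Real.log J - 2
        + 1 / (J : ℝ) * (∑ j, Real.exp (gp j ω) + ∑ j, Real.exp (gm j ω)) := by
      linarith
    -- The slope K = a/(1+a) is chosen for this line: after multiplication by 1 + a, moving a(St +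
    -- Sh) to the left leaves (1+a)(Sh − St) − a(Sh + St) = Sh − (1+2a)St. Minimality of the
    -- empirical risk of `jhat` lets Et − Eh be dropped.
    have hkey : Sh - (1 + 2 * a) * St
        ≤ (1 + a) / l * (gp (jtilde ω) ω + gm (jhat ω) ω) + t * (2 * a * s) := by
      have hlin : (1 + a) * (Et - Eh + Sh - St)
          ≤ (1 + a) / l * (gp (jtilde ω) ω + gm (jhat ω) ω) + a * (St + Sh + 2 * (t * s)) := by
        have h11 : l * (Et - Eh + Sh - St) ≤ gp (jtilde ω) ω + gm (jhat ω) ω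
            + l * (a / (1 + a)) * (St + Sh + 2 * (t * s)) := by linarith
        have h12 := mul_le_mul_of_nonneg_left h11 (show 0 ≤ (1 + a) / l by positivity)
        have e1 : (1 + a) / l * (l * (Et - Eh + Sh - St)) = (1 + a) * (Et - Eh + Sh - St) := by
          field_simp
        have e2 : (1 + a) / l * (gp (jtilde ω) ω + gm (jhat ω) ω
            + l * (a / (1 + a)) * (St + Sh + 2 * (t * s)))
            = (1 + a) / l * (gp (jtilde ω) ω + gm (jhat ω) ω)
              + a * (St + Sh + 2 * (t * s)) := by
          field_simp
        rwa [e1, e2] at h12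
      have h13 : 0 ≤ (1 + a) * (Et - Eh) := mul_nonneg (by positivity) (sub_nonneg.2 hE)
      linarith
    calc 1 / (t : ℝ) * Sh - (1 + 2 * a) * (1 / (t : ℝ) * St)
        = 1 / (t : ℝ) * (Sh - (1 + 2 * a) * St) := by ring
      _ ≤ 1 / (t : ℝ) * ((1 + a) / l * (2 * Real.log J - 2
          + 1 / (J : ℝ) * (∑ j, Real.exp (gp j ω) + ∑ j, Real.exp (gm j ω)))
            + t * (2 * a * s)) := by
          refine mul_le_mul_of_nonneg_left (hkey.trans ?_) (by positivity)
          gcongr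
      _ = V ω := by
          simp only [hV]
          field_simp
  refine (integral_mono_ae hUi hVi hle).trans ?_
  have hone : ∀ g : Fin J → Ω → ℝ, (∀ j, ∫ ω, Real.exp (g j ω) ∂P ≤ 1) →
      (∀ j, Integrable (fun ω => Real.exp (g j ω)) P) →
      ∫ ω, ∑ j, Real.exp (g j ω) ∂P ≤ J := by
    intro g h1 h2
    rw [integral_finsetSum _ fun j _ => h2 j]
    refine (Finset.sum_le_sum fun j _ => h1 j).trans_eq ?_
    simp
  have hp1 := hone gp (fun j => (hp j).2) fun j => (hp j).1
  have hm1 := hone gm (fun j => (hm j).2) fun j => (hm j).1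
  have hint : ∫ ω, V ω ∂P = (1 + a) / (t * l) * (2 * Real.log J - 2
      + 1 / (J : ℝ) * (∫ ω, ∑ j, Real.exp (gp j ω) ∂P + ∫ ω, ∑ j, Real.exp (gm j ω) ∂P))
      + 2 * a * s := by
    have hS := integral_add hsump hsumm
    have hSi : Integrable
        (fun ω => ∑ j, Real.exp (gp j ω) + ∑ j, Real.exp (gm j ω)) P := hsump.add hsumm
    have e : V = fun ω => ((1 + a) / (t * l) * (2 * Real.log J - 2) + 2 * a * s)
        + (1 + a) / (t * l) * (1 / (J : ℝ)) *
          (∑ j, Real.exp (gp j ω) + ∑ j, Real.exp (gm j ω)) := by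
      funext ω
      simp only [hV]
      ring
    rw [← hS, e, integral_add (integrable_const _) (hSi.const_mul _), integral_const_mul,
      integral_const, probReal_univ, one_smul]
    ring
  rw [hint]
  -- The two averages of exponential moments are at most 1 each and cancel the −2.
  have hin : 2 * Real.log J - 2 + 1 / (J : ℝ) *
      (∫ ω, ∑ j, Real.exp (gp j ω) ∂P + ∫ ω, ∑ j, Real.exp (gm j ω) ∂P) ≤ 2 * Real.log J := by
    have : 1 / (J : ℝ) * (∫ ω, ∑ j, Real.exp (gp j ω) ∂P + ∫ ω, ∑ j, Real.exp (gm j ω) ∂P)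
        ≤ 1 / (J : ℝ) * (J + J) := by gcongr
    have e : 1 / (J : ℝ) * (J + J) = 2 := by field_simp; norm_num
    linarith
  have h := mul_le_mul_of_nonneg_left hin (show 0 ≤ (1 + a) / (t * l) by positivity)
  have e : (1 + a) / (t * l) * (2 * Real.log J) = 2 * (1 + a) / t * (Real.log J / l) := by
    field_simp
  linarith

/-- The oracle inequality, up to the choice of an upper bound `Q` of the slow-rate term. -/
theorem integral_regret_le (hA0 : M.A0 P G) (hA1 : M.A1 P θs)
    (hA2 : M.A2 P θo b₁ b₂) (hA3 : M.A3 P θo β γ) (hϑ : ∀ j t, Measurable[M.F t] (ϑ j t))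
    (ht : 1 ≤ t) (hjhat_meas : Measurable jhat) (hjtilde_meas : Measurable jtilde)
    (hjhat : ∀ᵐ ω ∂P, ∀ j, M.empRisk (ϑ (jhat ω)) t ω ≤ M.empRisk (ϑ j) t ω)
    (ha : 0 < a) {Q : ℝ} (hQ0 : 0 < Q)
    (hQ : 2 * ((1 + a) ^ 2 * γ / a ^ β) * Real.log J / (t * ratio G) ≤ Q) :
    ∫ ω, (M.risk P (ϑ (jhat ω)) t ω - M.constRisk P θo t ω
        - (1 + 2 * a) * (M.risk P (ϑ (jtilde ω)) t ω - M.constRisk P θo t ω)) ∂P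
      ≤ 3 * Q ^ (1 / (2 - β)) + 4 * (1 + a) * b₂ * Real.log J / (t * ratio G) := by
  have ht' : (0 : ℝ) < t := by exact_mod_cast ht
  have ⟨hβ0, hβ1, hγ, _⟩ := hA3
  have hb2 : 0 < b₂ := hA2.2.2.1
  have hr : 0 < ratio G := zero_lt_one.trans_le (one_le_ratio G)
  have hL : 0 ≤ Real.log J := Real.log_natCast_nonneg J
  set r := ratio G
  set x := Q ^ (1 / (2 - β)) with hx
  have hx0 : 0 < x := Real.rpow_pos_of_pos hQ0 _
  -- x is the fixed point that balances the price 2as = 2x, for s = x/a, against the slow-rate term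
  -- Q/x^(1−β).
  have hxQ : x * x ^ (1 - β) = Q := by
    rw [← Real.rpow_one_add' hx0.le (by linarith), hx, ← Real.rpow_mul hQ0.le]
    have : 1 / (2 - β) * (1 + (1 - β)) = 1 := by
      have : (2 - β) ≠ 0 := by linarith
      field_simp
      ring
    rw [this, Real.rpow_one]
  set y := x ^ (1 - β) with hy
  have hy0 : 0 < y := Real.rpow_pos_of_pos hx0 _
  have hs : (x / a) ^ (1 - β) = y * a ^ β / a := by
    rw [Real.div_rpow hx0.le ha.le, Real.rpow_sub ha, Real.rpow_one, ← hy]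
    field_simp
  have haβ : 0 < a ^ β := Real.rpow_pos_of_pos ha _
  -- `l₁` turns the linearisation constraint into an equality at s = x/a, and `l₂` does so for the
  -- Bernstein range. Their minimum satisfies both, at the price of adding the two terms log J/l.
  set l₁ := r * y * a ^ β / ((1 + a) * γ) with hl₁
  set l₂ := r / (2 * b₂) with hl₂
  have hl₁0 : 0 < l₁ := by positivity
  have hl₂0 : 0 < l₂ := by positivity
  have hmain := integral_regret_le_of_tuning (l := min l₁ l₂) (s := x / a) hA0 hA1 hA2
    hA3 hϑ ht hjhat_meas hjtilde_meas hjhat ha (lt_min hl₁0 hl₂0) (by positivity)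
    (by
      calc min l₁ l₂ * (2 * b₂) ≤ l₂ * (2 * b₂) := by gcongr; exact min_le_right _ _
        _ = r := by rw [hl₂]; field_simp)
    (by
      rw [hs]
      calc min l₁ l₂ * (γ / r) ≤ l₁ * (γ / r) := by gcongr; exact min_le_left _ _
        _ = _ := by rw [hl₁]; field_simp)
  refine hmain.trans ?_
  have hinv : Real.log J / min l₁ l₂ ≤ Real.log J / l₁ + Real.log J / l₂ := by
    rcases min_choice l₁ l₂ with h | h <;> rw [h]
    · exact le_add_of_nonneg_right (by positivity)
    · exact le_add_of_nonneg_left (by positivity)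
  have h1 : 2 * (1 + a) / t * (Real.log J / l₁) ≤ x := by
    have e : 2 * (1 + a) / t * (Real.log J / l₁)
        = (2 * ((1 + a) ^ 2 * γ / a ^ β) * Real.log J / (t * r)) / y := by
      rw [hl₁]; field_simp
    rw [e, div_le_iff₀ hy0, hxQ]
    exact hQ
  have h2 : 2 * (1 + a) / t * (Real.log J / l₂) = 4 * (1 + a) * b₂ * Real.log J / (t * r) := by
    rw [hl₂]; field_simp; ring
  have h3 : 2 * a * (x / a) = 2 * x := by field_simp
  have h4 := mul_le_mul_of_nonneg_left hinv (show 0 ≤ 2 * (1 + a) / t by positivity)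
  rw [mul_add (2 * (1 + a) / (t : ℝ)), h2] at h4
  linarith

end Oracle

end SLModel

/-! ### The two stated bounds. -/

theorem corollary1
    {Ω 𝒜 𝒪 𝒵 Θ : Type*} [MeasurableSpace Ω] [StandardBorelSpace Ω]
    [Fintype 𝒜] [Nonempty 𝒜] [MeasurableSpace 𝒪] [MeasurableSpace 𝒵] [MeasurableSpace Θ]
    (P : Measure Ω) [IsProbabilityMeasure P] (M : SLModel Ω 𝒜 𝒪 𝒵 Θ)
    -- the algorithms
    (J : ℕ) (Θsub : Fin J → Set Θ)
    (alg : Fin J → (t : ℕ) → (Fin t → 𝒜 → 𝒪) → Θ)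
    (halg_meas : ∀ j t, Measurable (alg j t))
    (halg_mem : ∀ j t h, alg j t h ∈ Θsub j)
    -- the assumptions
    (G : SimpleGraph 𝒜) (θs θo : Θ) (b₁ b₂ β γ v₁ : ℝ)
    (hA0 : M.A0 P G) (hA1 : M.A1 P θs) (hA2 : M.A2 P θo b₁ b₂) (hA3 : M.A3 P θo β γ)
    (hA4 : M.A4 P θo v₁)
    (t : ℕ) (ht : 1 ≤ t)
    (hθo : ∀ j, ∀ θ ∈ Θsub j, M.constRisk P θo t ≤ᵐ[P] M.constRisk P θ t)
    -- the Super Learner and the oracle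
    (jhat jtilde : Ω → Fin J) (hjhat_meas : Measurable jhat) (hjtilde_meas : Measurable jtilde)
    (hjhat : ∀ᵐ ω ∂P, ∀ j,
      M.empRisk (M.output (alg (jhat ω))) t ω ≤ M.empRisk (M.output (alg j)) t ω)
    (hjtilde : ∀ᵐ ω ∂P, ∀ j,
      M.risk P (M.output (alg (jtilde ω))) t ω ≤ M.risk P (M.output (alg j)) t ω)
    (a : ℝ) (ha0 : 0 < a) (ha1 : a ≤ 1) :
    Integrable (fun ω =>
      M.risk P (M.output (alg (jhat ω))) t ω - M.constRisk P θo t ω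
        - (1 + 2 * a) * (M.risk P (M.output (alg (jtilde ω))) t ω - M.constRisk P θo t ω)) P ∧
    (∀ N : ℕ, 2 ≤ N →
      β / (2 - β) * ((Real.log t
        + Real.log (SuperLearner.C₃ β γ (SuperLearner.v₂ (SuperLearner.ratio G) b₂ v₁)))
          / Real.log 2) ≤ N →
      ∫ ω, (M.risk P (M.output (alg (jhat ω))) t ω - M.constRisk P θo t ω
        - (1 + 2 * a) *
          (M.risk P (M.output (alg (jtilde ω))) t ω - M.constRisk P θo t ω)) ∂P
      ≤ 3 * (SuperLearner.C₁ β γ a / t * Real.log (2 * J * N)) ^ (1 / (2 - β))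
        + 2 * SuperLearner.C₂ b₂ a / t * Real.log (2 * J * N)) ∧
    (∀ N' : ℕ, 2 ≤ N' →
      β / (2 - β) * ((Real.log (SuperLearner.ratio G / (t : ℝ) ^ β)
        + Real.log (SuperLearner.C₃' β γ b₁)) / Real.log 2) ≤ N' →
      ∫ ω, (M.risk P (M.output (alg (jhat ω))) t ω - M.constRisk P θo t ω
        - (1 + 2 * a) *
          (M.risk P (M.output (alg (jtilde ω))) t ω - M.constRisk P θo t ω)) ∂P
      ≤ 3 * (SuperLearner.C₁' β γ a / (SuperLearner.ratio G / (t : ℝ) ^ β)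
            * Real.log (2 * J * N')) ^ (1 / (2 - β))
        + 2 * SuperLearner.C₂' b₂ a / SuperLearner.ratio G * Real.log (2 * J * N')) := by
  have hϑ : ∀ j t, Measurable[M.F t] (M.output (alg j) t) :=
    fun j t => M.measurable_output (halg_meas j) t
  have hJ : 0 < J := by
    obtain ⟨ω₀⟩ : Nonempty Ω := nonempty_of_isProbabilityMeasure P
    exact (Nat.zero_le _).trans_lt (jhat ω₀).isLt
  have ht' : (1 : ℝ) ≤ t := by exact_mod_cast ht
  have ht0 : (0 : ℝ) < t := by linarith
  have hr := SuperLearner.one_le_ratio G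
  have hr0 : 0 < SuperLearner.ratio G := by linarith
  have ⟨hβ0, hβ1, hγ, _⟩ := hA3
  have hb2 : 0 < b₂ := hA2.2.2.1
  have hLJ : 0 ≤ Real.log J := Real.log_natCast_nonneg J
  have haβ : 0 < a ^ β := Real.rpow_pos_of_pos ha0 _
  -- Strict positivity holds even when J = 1; it makes Q > 0 in `integral_regret_le`.
  have hL : ∀ N : ℕ, 2 ≤ N → Real.log J ≤ Real.log (2 * J * N) ∧ 0 < Real.log (2 * J * N) := by
    intro N hN
    have hJ1 : (1 : ℝ) ≤ J := by exact_mod_cast hJ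
    have hN1 : (2 : ℝ) ≤ N := by exact_mod_cast hN
    have h1 : (J : ℝ) < 2 * J * N := by nlinarith
    exact ⟨Real.log_le_log (by linarith) h1.le, Real.log_pos (by linarith)⟩
  set r := SuperLearner.ratio G
  have hbase : 0 < (1 + a) ^ 2 * γ / a ^ β := by positivity
  refine ⟨?_, fun N hN _ => ?_, fun N hN _ => ?_⟩
  · exact (SuperLearner.integrable_select
      (fun j => SLModel.integrable_risk_sub_constRisk hA1 hA2 (hϑ j) t) hjhat_meas).sub
      ((SuperLearner.integrable_select
        (fun j => SLModel.integrable_risk_sub_constRisk hA1 hA2 (hϑ j) t) hjtilde_meas).const_mul _)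
  · obtain ⟨hL1, hL0⟩ := hL N hN
    set L := Real.log (2 * J * N)
    have hpow : (2 : ℝ) ≤ 2 ^ (5 - β) := by
      have := Real.rpow_le_rpow_of_exponent_le (one_le_two (α := ℝ)) (show 1 ≤ 5 - β by linarith)
      simpa using this
    have hC : SuperLearner.C₁ β γ a = 2 ^ (5 - β) * ((1 + a) ^ 2 * γ / a ^ β) := by
      rw [SuperLearner.C₁]; ring
    have hCpos : 0 < SuperLearner.C₁ β γ a := by rw [hC]; positivity
    refine (SLModel.integral_regret_le hA0 hA1 hA2 hA3 hϑ ht hjhat_meas hjtilde_meas hjhat ha0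
      (Q := SuperLearner.C₁ β γ a / t * L) (by positivity) ?_).trans ?_
    -- Here r ≥ 1 is discarded and the rate in t kept.
    · rw [hC]
      calc 2 * ((1 + a) ^ 2 * γ / a ^ β) * Real.log J / (t * r)
          ≤ 2 ^ (5 - β) * ((1 + a) ^ 2 * γ / a ^ β) * L / (t * 1) := by gcongr
        _ = _ := by ring
    · have : 4 * (1 + a) * b₂ * Real.log J / (t * r) ≤ 2 * SuperLearner.C₂ b₂ a / t * L := by
        calc 4 * (1 + a) * b₂ * Real.log J / (t * r)
            ≤ (16 / 3) * (1 + a) * b₂ * L / (t * 1) := by gcongr; norm_num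
          _ = _ := by rw [SuperLearner.C₂]; ring
      linarith
  · obtain ⟨hL1, hL0⟩ := hL N hN
    set L := Real.log (2 * J * N)
    have he : 1 ≤ Real.exp 1 := Real.one_le_exp zero_le_one
    have hpow : (2 : ℝ) ≤ 2 ^ (6 + 2 * β) * Real.exp 1 ^ 2 := by
      have h1 := Real.rpow_le_rpow_of_exponent_le (one_le_two (α := ℝ))
        (show 1 ≤ 6 + 2 * β by linarith)
      rw [Real.rpow_one] at h1
      exact h1.trans (le_mul_of_one_le_right (by positivity) (one_le_pow₀ he))
    have htβ : 1 ≤ (t : ℝ) ^ β := Real.one_le_rpow ht' hβ0.le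
    have hC : SuperLearner.C₁' β γ a
        = 2 ^ (6 + 2 * β) * Real.exp 1 ^ 2 * ((1 + a) ^ 2 * γ / a ^ β) := by
      rw [SuperLearner.C₁']; ring
    have hCpos : 0 < SuperLearner.C₁' β γ a := by rw [hC]; positivity
    refine (SLModel.integral_regret_le hA0 hA1 hA2 hA3 hϑ ht hjhat_meas hjtilde_meas hjhat ha0
      (Q := SuperLearner.C₁' β γ a / (r / (t : ℝ) ^ β) * L) (by positivity) ?_).trans ?_
    -- Here t ≥ 1 is discarded from the denominator, and the bound is enlarged further by t^β ≥ 1 to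
    -- reach the stated rate in r/t^β.
    · rw [hC]
      calc 2 * ((1 + a) ^ 2 * γ / a ^ β) * Real.log J / (t * r)
          ≤ 2 ^ (6 + 2 * β) * Real.exp 1 ^ 2 * ((1 + a) ^ 2 * γ / a ^ β) * L / (1 * r) := by gcongr
        _ ≤ 2 ^ (6 + 2 * β) * Real.exp 1 ^ 2 * ((1 + a) ^ 2 * γ / a ^ β) * L / (1 * r)
              * (t : ℝ) ^ β := le_mul_of_one_le_right (by positivity) htβ
        _ = _ := by field_simp
    · have : 4 * (1 + a) * b₂ * Real.log J / (t * r) ≤ 2 * SuperLearner.C₂' b₂ a / r * L := by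
        calc 4 * (1 + a) * b₂ * Real.log J / (t * r)
            ≤ (120 * Real.exp 1) * (1 + a) * b₂ * L / (1 * r) := by
              gcongr
              linarith
          _ = _ := by rw [SuperLearner.C₂']; ring
      linarith
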